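/- Let $q\in\{2,3,4,5\}$ and let $M$ be a finite matroid of rank $r$ with no $U_{2,q+2}$-minor, i.e. no minor of $M$ is isomorphic to the uniform matroid $U_{2,q+2}$ of rank $2$ on $q+2$ elements. Let $W_2(M)$ denote the number of lines of $M$, where a line is a flat of rank $2$. Then $$W_2(M)\;\le\;\binom{r}{2}_{\!q}=\frac{(q^{r}-1)(q^{r-1}-1)}{(q-1)(q^{2}-1)}.$$ -/

import Mathlib

namespace LinesMatroid

/-- The uniform matroid `U_{k,n}` on the `n`-element set `Fin n`: a set is independent if and only
if it has at most `k` elements. -/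
noncomputable def uniform (k n : ℕ) : Matroid (Fin n) :=
  (IndepMatroid.ofFinite (E := Set.univ) Set.finite_univ
    (fun I => I.ncard ≤ k)
    (by simp)
    (fun I J hJ hIJ => (Set.ncard_le_ncard hIJ J.toFinite).trans hJ)
    (by
      intro I J _ hJ hIJ
      obtain ⟨e, heJ, heI⟩ := Set.exists_mem_notMem_of_ncard_lt_ncard hIJ I.toFinite
      refine ⟨e, heJ, heI, ?_⟩
      rw [Set.ncard_insert_of_notMem heI I.toFinite]
      omega)
    (fun I _ => Set.subset_univ I)).matroid

theorem uniform_ground (k n : ℕ) : (uniform k n).E = Set.univ := rfl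

theorem uniform_indep_iff (k n : ℕ) (I : Set (Fin n)) :
    (uniform k n).Indep I ↔ I.ncard ≤ k := by
  simp [uniform]

/-- Two matroids are isomorphic if there is a bijection between their ground sets under which a set
is independent in the first if and only if its image is independent in the second. -/
def IsIsomorphic {α β : Type*} (M : Matroid α) (N : Matroid β) : Prop :=
  ∃ f : M.E ≃ N.E, ∀ I : Set M.E,
    M.Indep (Subtype.val '' I) ↔ N.Indep (Subtype.val '' (f '' I))

/-- The class `𝓤(ℓ)` of matroids with no `U_{2,ℓ+2}`-minor, that is, having no minor isomorphic to
`U_{2,ℓ+2}`. -/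
def NoLineMinor {α : Type*} (ℓ : ℕ) (M : Matroid α) : Prop :=
  ∀ N : Matroid α, N.IsMinor M → ¬ IsIsomorphic N (uniform 2 (ℓ + 2))

/-- The lines of a matroid: the flats of rank two. -/
def lines {α : Type*} (M : Matroid α) : Set (Set α) :=
  {L | M.IsFlat L ∧ M.eRk L = 2}

/-- `W₂(M)`, the number of lines of a (finite) matroid `M`. -/
noncomputable def numLines {α : Type*} (M : Matroid α) : ℕ := (lines M).ncard

/-- The `q`-binomial coefficient `[r choose 2]_q`, for `q ≥ 2`. For `r = 0` the first factor
vanishes, so the truncated exponent `r - 1` is harmless. -/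
def qBinomTwo (q r : ℕ) : ℚ :=
  (((q : ℚ) ^ r - 1) * ((q : ℚ) ^ (r - 1) - 1)) / (((q : ℚ) - 1) * ((q : ℚ) ^ 2 - 1))

end LinesMatroid

/-!
The bound is proved for flats above an arbitrary flat `F`, by induction on the corank `m` of `F`.
Fix a flat `E₀` covering `F`. The flats of rank two more than `F` that contain `E₀` cover `E₀`, and
by Kung's argument (`ncard_covers_le`) there are at most `1 + q + ⋯ + q ^ (m - 2)` of them. Every
other such flat spans with `E₀` a flat of rank two more than `E₀`, so it suffices that each
interval of length three in the lattice of flats has at most `q ^ 2` lines that avoid a given point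
(`ncard_not_subset_le`); the resulting recursion `lineBound` is solved by the `q`-binomial
coefficient. The hypothesis on minors enters only through `ncard_flatsBetween_le`: an interval of
length two has at most `q + 1` atoms. So an interval of length three is a finite linear space in
which every point is on at most `q + 1` lines, and the heart of the matter is
`LinearSpace.card_avoid_le`: in such a space at most `q ^ 2` lines avoid a given point `e`.

If some line has `q + 1` points then it meets every line, and counting the lines through its points
suffices (`card_avoid_le_of_long_line`). Otherwise `(#ℓ - 2) * (q - #ℓ) ≥ 0` for all lines `ℓ`;
summed over the lines that avoid `e`, this settles `q ≤ 4` (`card_avoid_le_of_le_four`).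

For `q = 5` the count falls short. Suppose that `26` lines avoid `e` and that all lines have at
most five points. A weighted count gives two five-point lines `L` and `M` that meet
(`exists_meeting_of_avoid`). A point off `L` is on at most one line that misses `L`, and counting
all lines through `L` shows that at least six lines miss `L`, apart from one exceptional
configuration with five such lines. Let `f₀, …, f₄` be the points of `L`, with `f₀` on `M`. A point
`y` off `L` is encoded by the word of length five whose symbol at position `j` names the line
through `f j` and `y`, out of at most five lines other than `L`. The words of two points agree in
exactly one position if the line of the two points meets `L`, and nowhere if it misses `L`
(`exists_words`). The six lines that miss `L` thus provide six pairs of words, the words in a pair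
agreeing nowhere and words from different pairs agreeing once. The four points of `M` other than
`f₀` have the words `(0, i, i, i, i)`, which leaves so few possibilities for the other words that
all of them can be searched (`Word.search`, evaluated in the kernel). The outcome is that such a
system of twelve words cannot be extended, so that it contains all points off `L`, and that in at
least two positions some symbol is not used; the latter means that too few lines pass through two
points of `L`, contradicting that `26` lines avoid `e`.
-/

namespace LinesMatroid

/-! ### Words of length five -/

/-- A word of length five over the natural numbers; the symbols that occur are less than five. -/
structure Word where
  (c0 c1 c2 c3 c4 : ℕ)

namespace Word

/-- The number of positions in which two words agree. -/
def agree (u v : Word) : ℕ :=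
  (Nat.beq u.c0 v.c0).toNat + (Nat.beq u.c1 v.c1).toNat + (Nat.beq u.c2 v.c2).toNat +
    (Nat.beq u.c3 v.c3).toNat + (Nat.beq u.c4 v.c4).toNat

/-- All words with symbols less than five. -/
def all : List Word :=
  [0, 1, 2, 3, 4].flatMap fun a => [0, 1, 2, 3, 4].flatMap fun b => [0, 1, 2, 3, 4].flatMap fun c =>
    [0, 1, 2, 3, 4].flatMap fun d => [0, 1, 2, 3, 4].map fun e => ⟨a, b, c, d, e⟩

/-- The words in a list that agree with `u` in exactly `k` positions. -/
def select (u : Word) (k : ℕ) (l : List Word) : List Word := l.filter fun v => (agree u v).beq k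

/-- For `1 ≤ i ≤ 4`, the word of the `i`-th point of the second five-point line `M`. That line
passes through the point of `L` with index `0`, where its label is `0`. -/
def pivot (i : ℕ) : Word := ⟨0, i, i, i, i⟩

/-- The word of a point on a line that misses `L` and `M`; the points and labels can be chosen so
that it has this form. -/
def base : Word := ⟨1, 1, 2, 3, 4⟩

/-- The words of the points from which no line to one of the points of `M` off `L` misses `L`. -/
def candUnpaired : List Word :=
  select (pivot 4) 1 (select (pivot 3) 1 (select (pivot 2) 1 (select (pivot 1) 1 all)))

/-- The words, agreeing once with `base`, of the points whose line to the `i`-th point of `M`, but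
to no other point of `M`, misses `L`. -/
def candPartner (i : ℕ) : List Word :=
  select base 1 (select (pivot 4) (bif i.beq 4 then 0 else 1)
    (select (pivot 3) (bif i.beq 3 then 0 else 1) (select (pivot 2) (bif i.beq 2 then 0 else 1)
      (select (pivot 1) (bif i.beq 1 then 0 else 1) all))))

/-- Whether some word in the list has the symbol `s` in the position read off by `f`. -/
def hasSym (s : ℕ) (f : Word → ℕ) (l : List Word) : Bool := l.any fun v => (f v).beq s

/-- `1` if all five symbols occur in the position read off by `f`, and `0` otherwise. -/
def full (f : Word → ℕ) (l : List Word) : ℕ :=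
  (hasSym 0 f l && (hasSym 1 f l && (hasSym 2 f l && (hasSym 3 f l && hasSym 4 f l)))).toNat

/-- The number of positions in which all five symbols occur. -/
def numFull (l : List Word) : ℕ := full c0 l + full c1 l + full c2 l + full c3 l + full c4 l

/-- Whether `check` succeeds for all words `y₁, …, y₄` from the four lists that agree pairwise in
exactly one position. -/
def partners (Q₁ Q₂ Q₃ Q₄ : List Word) (check : Word → Word → Word → Word → Bool) : Bool :=
  Q₁.all fun y₁ => (select y₁ 1 Q₂).all fun y₂ => (select y₂ 1 (select y₁ 1 Q₃)).all fun y₃ =>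
    (select y₃ 1 (select y₂ 1 (select y₁ 1 Q₄))).all fun y₄ => check y₁ y₂ y₃ y₄

/-- Whether no word in `Q` agrees nowhere with `u` and once with each of `a`, `b`, `c`. -/
def noExt (u a b c : Word) (Q : List Word) : Bool :=
  (select c 1 (select b 1 (select a 1 (select u 0 Q)))).isEmpty

/-- For every choice of partners of the four pivots, the words `ws`, the pivots and the partners use
all five symbols in at most three positions, and no pivot has a second partner. -/
def pairCheck (ws : List Word) (Q₁ Q₂ Q₃ Q₄ : List Word) : Bool :=
  partners Q₁ Q₂ Q₃ Q₄ fun y₁ y₂ y₃ y₄ =>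
    Nat.ble (numFull (y₁ :: y₂ :: y₃ :: y₄ :: pivot 1 :: pivot 2 :: pivot 3 :: pivot 4 :: ws)) 3 &&
    (noExt y₁ y₂ y₃ y₄ Q₁ && (noExt y₂ y₁ y₃ y₄ Q₂ && (noExt y₃ y₁ y₂ y₄ Q₃ &&
      noExt y₄ y₁ y₂ y₃ Q₄)))

/-- For every choice of partners of the four pivots, the words `ws`, the pivots and the partners use
all five symbols in at most four positions. -/
def singleCheck (ws : List Word) (Q₁ Q₂ Q₃ Q₄ : List Word) : Bool :=
  partners Q₁ Q₂ Q₃ Q₄ fun y₁ y₂ y₃ y₄ =>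
    Nat.ble (numFull (y₁ :: y₂ :: y₃ :: y₄ :: pivot 1 :: pivot 2 :: pivot 3 :: pivot 4 :: ws)) 4

/-- The search. The words `base` and `p` belong to two points on a line that misses `L` and `M`. The
word `u` belongs to another point from which no line to `M` misses `L`, and `v`, where present, to
a point that shares with that of `u` a line missing `L`. The symbol `2` of `p` in position `0` is a
choice of labels. -/
def search : Bool :=
  (select base 0 candUnpaired).all fun p => !(p.c0.beq 2) ||
    ((select p 1 (select base 1 candUnpaired)).all fun u =>
      singleCheck [base, p, u] (select u 1 (select p 1 (candPartner 1)))
        (select u 1 (select p 1 (candPartner 2))) (select u 1 (select p 1 (candPartner 3)))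
        (select u 1 (select p 1 (candPartner 4))) &&
      (select u 0 (select p 1 (select base 1 candUnpaired))).all fun v =>
        ((select v 1 (select u 1 (select p 1 (select base 1 candUnpaired)))).isEmpty &&
          ((select v 0 (select u 0 (select p 1 (select base 1 candUnpaired)))).isEmpty &&
            (select v 1 (select u 1 (select p 0 (select base 0 candUnpaired)))).isEmpty)) &&
        pairCheck [base, p, u, v] (select v 1 (select u 1 (select p 1 (candPartner 1))))
          (select v 1 (select u 1 (select p 1 (candPartner 2))))
          (select v 1 (select u 1 (select p 1 (candPartner 3))))
          (select v 1 (select u 1 (select p 1 (candPartner 4)))))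

/-- No system of words survives the search. Each choice prunes the lists below it, which keeps the
number of cases small enough for evaluation in the kernel. -/
theorem search_eq_true : search = true := by decide +kernel

lemma mem_select {u v : Word} {k : ℕ} {l : List Word} :
    v ∈ select u k l ↔ v ∈ l ∧ agree u v = k := by
  simp [select]

lemma mem_all {w : Word} (h₀ : w.c0 < 5) (h₁ : w.c1 < 5) (h₂ : w.c2 < 5) (h₃ : w.c3 < 5)
    (h₄ : w.c4 < 5) : w ∈ all := by
  have key : ∀ a < 5, a ∈ [0, 1, 2, 3, 4] := by decide
  simp only [all, List.mem_flatMap, List.mem_map]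
  exact ⟨w.c0, key _ h₀, w.c1, key _ h₁, w.c2, key _ h₂, w.c3, key _ h₃, w.c4, key _ h₄, rfl⟩

lemma mem_candUnpaired {w : Word} (hw : w ∈ all) (h : ∀ i ∈ Finset.Icc 1 4, agree (pivot i) w = 1) :
    w ∈ candUnpaired := by
  simp only [candUnpaired, mem_select]
  exact ⟨⟨⟨⟨hw, h 1 (by decide)⟩, h 2 (by decide)⟩, h 3 (by decide)⟩, h 4 (by decide)⟩

lemma mem_candPartner {w : Word} (hw : w ∈ all) {i : ℕ}
    (h : ∀ j ∈ Finset.Icc 1 4, agree (pivot j) w = if i = j then 0 else 1) (h₅ : agree base w = 1) :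
    w ∈ candPartner i := by
  have key : ∀ j, (bif i.beq j then 0 else 1) = if i = j then 0 else 1 := by
    intro j
    by_cases hij : i = j
    · subst hij; simp
    · have : i.beq j = false := by
        rw [Bool.eq_false_iff, Ne, Nat.beq_eq]; exact hij
      simp [this, hij]
  simp only [candPartner, mem_select, key]
  exact ⟨⟨⟨⟨⟨hw, h 1 (by decide)⟩, h 2 (by decide)⟩, h 3 (by decide)⟩, h 4 (by decide)⟩, h₅⟩

lemma partners_spec {Q₁ Q₂ Q₃ Q₄ : List Word} {check : Word → Word → Word → Word → Bool}
    (h : partners Q₁ Q₂ Q₃ Q₄ check = true) {y₁ y₂ y₃ y₄ : Word} (h₁ : y₁ ∈ Q₁) (h₂ : y₂ ∈ Q₂)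
    (h₃ : y₃ ∈ Q₃) (h₄ : y₄ ∈ Q₄) (h₁₂ : agree y₁ y₂ = 1) (h₁₃ : agree y₁ y₃ = 1)
    (h₁₄ : agree y₁ y₄ = 1) (h₂₃ : agree y₂ y₃ = 1) (h₂₄ : agree y₂ y₄ = 1)
    (h₃₄ : agree y₃ y₄ = 1) :
    check y₁ y₂ y₃ y₄ = true := by
  simp only [partners, List.all_eq_true, mem_select] at h
  exact h y₁ h₁ y₂ ⟨h₂, h₁₂⟩ y₃ ⟨⟨h₃, h₁₃⟩, h₂₃⟩ y₄ ⟨⟨⟨h₄, h₁₄⟩, h₂₄⟩, h₃₄⟩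

lemma noExt_spec {u a b c z : Word} {Q : List Word} (h : noExt u a b c Q = true) (hz : z ∈ Q)
    (hu : agree u z = 0) (ha : agree a z = 1) (hb : agree b z = 1) (hc : agree c z = 1) :
    False := by
  rw [noExt, List.isEmpty_iff] at h
  have : z ∈ select c 1 (select b 1 (select a 1 (select u 0 Q))) := by
    simp only [mem_select]; exact ⟨⟨⟨⟨hz, hu⟩, ha⟩, hb⟩, hc⟩
  simp [h] at this

/-- The outcome of the search for the words `base`, `p` of two points on one line and the words `u`,
`v` of two points on another line, both lines missing `L` and `M`. No point whose lines to `M` all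
meet `L` can be added, be it on neither line, on the second, or on the first; this is what the
three statements about `z` say. -/
lemma search_spec {p u : Word} (hp : p ∈ candUnpaired) (hp5 : agree base p = 0) (hp2 : p.c0 = 2)
    (hu : u ∈ candUnpaired) (hu5 : agree base u = 1) (hup : agree p u = 1) :
    singleCheck [base, p, u] (select u 1 (select p 1 (candPartner 1)))
        (select u 1 (select p 1 (candPartner 2)))
        (select u 1 (select p 1 (candPartner 3))) (select u 1 (select p 1 (candPartner 4))) = true ∧
      ∀ v ∈ candUnpaired, agree base v = 1 → agree p v = 1 → agree u v = 0 →
        ((∀ z ∈ candUnpaired, agree base z = 1 → agree p z = 1 → agree u z = 1 → agree v z ≠ 1) ∧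
          (∀ z ∈ candUnpaired, agree base z = 1 → agree p z = 1 → agree u z = 0 → agree v z ≠ 0) ∧
          (∀ z ∈ candUnpaired, agree base z = 0 → agree p z = 0 → agree u z = 1 → agree v z ≠ 1)) ∧
        pairCheck [base, p, u, v] (select v 1 (select u 1 (select p 1 (candPartner 1))))
          (select v 1 (select u 1 (select p 1 (candPartner 2))))
          (select v 1 (select u 1 (select p 1 (candPartner 3))))
          (select v 1 (select u 1 (select p 1 (candPartner 4)))) = true := by
  have h := search_eq_true
  simp only [search, List.all_eq_true, mem_select, Bool.or_eq_true, Bool.and_eq_true,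
    Bool.not_eq_true', List.isEmpty_iff, List.eq_nil_iff_forall_not_mem] at h
  have h1 := (h p ⟨hp, hp5⟩).resolve_left (by simp [hp2]) u ⟨⟨hu, hu5⟩, hup⟩
  refine ⟨h1.1, fun v hv hv5 hvp hvu => ?_⟩
  have h2 := h1.2 v ⟨⟨⟨hv, hv5⟩, hvp⟩, hvu⟩
  exact ⟨⟨fun z hz a b c d => h2.1.1 z ⟨⟨⟨⟨hz, a⟩, b⟩, c⟩, d⟩,
    fun z hz a b c d => h2.1.2.1 z ⟨⟨⟨⟨hz, a⟩, b⟩, c⟩, d⟩,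
    fun z hz a b c d => h2.1.2.2 z ⟨⟨⟨⟨hz, a⟩, b⟩, c⟩, d⟩⟩, h2.2⟩

lemma singleCheck_spec {ws Q₁ Q₂ Q₃ Q₄ : List Word}
    (h : singleCheck ws Q₁ Q₂ Q₃ Q₄ = true) {y₁ y₂ y₃ y₄ : Word} (h₁ : y₁ ∈ Q₁) (h₂ : y₂ ∈ Q₂)
    (h₃ : y₃ ∈ Q₃) (h₄ : y₄ ∈ Q₄) (h₁₂ : agree y₁ y₂ = 1) (h₁₃ : agree y₁ y₃ = 1)
    (h₁₄ : agree y₁ y₄ = 1) (h₂₃ : agree y₂ y₃ = 1) (h₂₄ : agree y₂ y₄ = 1)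
    (h₃₄ : agree y₃ y₄ = 1) :
    numFull (y₁ :: y₂ :: y₃ :: y₄ :: pivot 1 :: pivot 2 :: pivot 3 :: pivot 4 :: ws) ≤ 4 := by
  simpa [Nat.ble_eq] using partners_spec h h₁ h₂ h₃ h₄ h₁₂ h₁₃ h₁₄ h₂₃ h₂₄ h₃₄

lemma pairCheck_spec {ws Q₁ Q₂ Q₃ Q₄ : List Word}
    (h : pairCheck ws Q₁ Q₂ Q₃ Q₄ = true) {y₁ y₂ y₃ y₄ : Word} (h₁ : y₁ ∈ Q₁) (h₂ : y₂ ∈ Q₂)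
    (h₃ : y₃ ∈ Q₃) (h₄ : y₄ ∈ Q₄) (h₁₂ : agree y₁ y₂ = 1) (h₁₃ : agree y₁ y₃ = 1)
    (h₁₄ : agree y₁ y₄ = 1) (h₂₃ : agree y₂ y₃ = 1) (h₂₄ : agree y₂ y₄ = 1)
    (h₃₄ : agree y₃ y₄ = 1) :
    numFull (y₁ :: y₂ :: y₃ :: y₄ :: pivot 1 :: pivot 2 :: pivot 3 :: pivot 4 :: ws) ≤ 3 ∧
      noExt y₁ y₂ y₃ y₄ Q₁ = true ∧ noExt y₂ y₁ y₃ y₄ Q₂ = true ∧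
      noExt y₃ y₁ y₂ y₄ Q₃ = true ∧ noExt y₄ y₁ y₂ y₃ Q₄ = true := by
  simpa [Nat.ble_eq] using partners_spec h h₁ h₂ h₃ h₄ h₁₂ h₁₃ h₁₄ h₂₃ h₂₄ h₃₄

end Word
end LinesMatroid

namespace LinesMatroid

open Finset

/-! ### Finite linear spaces -/

/-- A finite linear space: lines are sets of at least two points, and any two distinct points are on
exactly one line. Degenerate spaces, with at most one line, are allowed. -/
structure LinearSpace (V : Type*) [Fintype V] [DecidableEq V] where
  lines : Finset (Finset V)
  two_le_card : ∀ ℓ ∈ lines, 2 ≤ #ℓ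
  exists_line : ∀ x y, x ≠ y → ∃ ℓ ∈ lines, x ∈ ℓ ∧ y ∈ ℓ
  line_unique : ∀ ℓ ∈ lines, ∀ m ∈ lines, ∀ x y, x ≠ y → x ∈ ℓ → y ∈ ℓ → x ∈ m → y ∈ m → ℓ = m

namespace LinearSpace

variable {V : Type*} [Fintype V] [DecidableEq V] (P : LinearSpace V)

/-- The lines through a point. -/
def pencil (x : V) : Finset (Finset V) := P.lines.filter (x ∈ ·)

/-- The lines that avoid a point. -/
def avoid (x : V) : Finset (Finset V) := P.lines.filter (x ∉ ·)

/-- The lines disjoint from a given set of points. -/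
def missing (L : Finset V) : Finset (Finset V) := P.lines.filter (Disjoint L)

open Classical in
/-- The line through two distinct points; the empty set if the points coincide. -/
noncomputable def join (x y : V) : Finset V :=
  if h : x ≠ y then (P.exists_line x y h).choose else ∅

variable {P} {x y z e : V} {ℓ m L : Finset V}

lemma mem_pencil : ℓ ∈ P.pencil x ↔ ℓ ∈ P.lines ∧ x ∈ ℓ := by simp [pencil]

lemma mem_avoid : ℓ ∈ P.avoid x ↔ ℓ ∈ P.lines ∧ x ∉ ℓ := by simp [avoid]

lemma mem_missing : ℓ ∈ P.missing L ↔ ℓ ∈ P.lines ∧ Disjoint L ℓ := by simp [missing]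

lemma join_spec (h : x ≠ y) : P.join x y ∈ P.lines ∧ x ∈ P.join x y ∧ y ∈ P.join x y := by
  rw [join, dif_pos h]
  exact (P.exists_line x y h).choose_spec

lemma join_mem (h : x ≠ y) : P.join x y ∈ P.lines := (join_spec h).1

lemma left_mem_join (h : x ≠ y) : x ∈ P.join x y := (join_spec h).2.1

lemma right_mem_join (h : x ≠ y) : y ∈ P.join x y := (join_spec h).2.2

lemma eq_join (h : x ≠ y) (hℓ : ℓ ∈ P.lines) (hx : x ∈ ℓ) (hy : y ∈ ℓ) : ℓ = P.join x y :=
  P.line_unique ℓ hℓ _ (join_mem h) x y h hx hy (left_mem_join h) (right_mem_join h)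

lemma join_comm : P.join x y = P.join y x := by
  by_cases h : x = y
  · rw [h]
  · exact eq_join (Ne.symm h) (join_mem h) (right_mem_join h) (left_mem_join h)

lemma eq_of_mem (hℓ : ℓ ∈ P.lines) (hm : m ∈ P.lines) (h : ℓ ≠ m) (hx : x ∈ ℓ) (hy : y ∈ ℓ)
    (hx' : x ∈ m) (hy' : y ∈ m) : x = y := by
  by_contra hxy
  exact h (P.line_unique ℓ hℓ m hm x y hxy hx hy hx' hy')

lemma card_lines_eq (e : V) : #P.lines = #(P.avoid e) + #(P.pencil e) := by
  rw [add_comm]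
  exact (card_filter_add_card_filter_not _).symm

/-! ### Counting lines in a linear space -/

lemma sum_pencil (x : V) : ∑ ℓ ∈ P.pencil x, ((#ℓ : ℤ) - 1) = Fintype.card V - 1 := by
  have h1 : (univ.erase x : Finset V) = (P.pencil x).biUnion (·.erase x) := by
    ext y
    simp only [mem_erase, mem_univ, and_true, mem_biUnion, mem_pencil]
    constructor
    · intro h
      exact ⟨P.join x y, ⟨join_mem h.symm, left_mem_join h.symm⟩, h, right_mem_join h.symm⟩
    · rintro ⟨ℓ, -, h, -⟩; exact h
  have h2 : #(univ.erase x : Finset V) = ∑ ℓ ∈ P.pencil x, #(ℓ.erase x) := by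
    rw [h1, card_biUnion]
    intro ℓ hℓ m hm hne
    rw [mem_coe, mem_pencil] at hℓ hm
    change Disjoint _ _
    rw [Finset.disjoint_left]
    intro y hy hy'
    rw [mem_erase] at hy hy'
    exact hy.1 (eq_of_mem hℓ.1 hm.1 hne hy.2 hℓ.2 hy'.2 hm.2)
  have h3 : ∀ ℓ ∈ P.pencil x, ((#ℓ : ℤ) - 1) = (#(ℓ.erase x) : ℤ) := by
    intro ℓ hℓ
    rw [cast_card_erase_of_mem (mem_pencil.1 hℓ).2]
  rw [sum_congr rfl h3, ← Nat.cast_sum, ← h2, cast_card_erase_of_mem (mem_univ x), card_univ]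

lemma join_mem_pencil (h : x ≠ e) : P.join e x ∈ P.pencil x :=
  mem_pencil.2 ⟨join_mem h.symm, right_mem_join h.symm⟩

/-- Double counting of the pairs of a line avoiding `e` and a point on it. The lines through `x`
that avoid `e` are all lines through `x` but the line of `e` and `x`. -/
lemma sum_avoid (e : V) (g : Finset V → ℤ) :
    ∑ ℓ ∈ P.avoid e, (#ℓ : ℤ) * g ℓ =
      ∑ x ∈ univ.erase e, ∑ ℓ ∈ (P.pencil x).erase (P.join e x), g ℓ := by
  have h1 : ∀ ℓ ∈ P.avoid e, (#ℓ : ℤ) * g ℓ = ∑ x ∈ ℓ, g ℓ := by intro ℓ _; simp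
  rw [sum_congr rfl h1]
  refine sum_comm' fun ℓ x => ?_
  simp only [mem_avoid, mem_erase, mem_univ, and_true, mem_pencil]
  constructor
  · rintro ⟨⟨h1, h2⟩, h3⟩
    have hxe : x ≠ e := by rintro rfl; exact h2 h3
    refine ⟨⟨?_, h1, h3⟩, hxe⟩
    rintro rfl
    exact h2 (left_mem_join hxe.symm)
  · rintro ⟨⟨h1, h2, h3⟩, h4⟩
    exact ⟨⟨h2, fun h5 => h1 (eq_join h4.symm h2 h5 h3)⟩, h3⟩

lemma sum_pencil_erase (h : x ≠ e) (c : ℤ) :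
    ∑ ℓ ∈ (P.pencil x).erase (P.join e x), (c - ((#ℓ : ℤ) - 1)) =
      c * (#(P.pencil x) - 1) - (Fintype.card V - #(P.join e x)) := by
  rw [sum_sub_distrib, sum_const, nsmul_eq_mul, cast_card_erase_of_mem (join_mem_pencil h),
    sum_erase_eq_sub (join_mem_pencil h), sum_pencil]
  ring

/-- The lines from a point off `L` to the points of `L` are all different. -/
lemma card_filter_pencil (hL : L ∈ P.lines) (hx : x ∉ L) :
    #{ℓ ∈ P.pencil x | ¬ Disjoint L ℓ} = #L := by
  symm
  refine card_bij (fun y _ => P.join x y) ?_ ?_ ?_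
  · intro y hy
    have hxy : x ≠ y := by rintro rfl; exact hx hy
    rw [mem_filter, mem_pencil]
    exact ⟨⟨join_mem hxy, left_mem_join hxy⟩, Finset.not_disjoint_iff.2
      ⟨y, hy, right_mem_join hxy⟩⟩
  · intro y hy z hz h
    have hxy : x ≠ y := by rintro rfl; exact hx hy
    have hxz : x ≠ z := by rintro rfl; exact hx hz
    refine eq_of_mem (join_mem (P := P) hxy) hL ?_ (right_mem_join hxy)
      (by rw [h]; exact right_mem_join hxz) hy hz
    rintro rfl
    exact hx (left_mem_join hxy)
  · intro ℓ hℓ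
    rw [mem_filter, mem_pencil, Finset.not_disjoint_iff] at hℓ
    obtain ⟨⟨h1, h2⟩, y, h3, h4⟩ := hℓ
    have hxy : x ≠ y := by rintro rfl; exact hx h3
    exact ⟨y, h3, (eq_join hxy h1 h2 h4).symm⟩

lemma card_filter_pencil_disjoint (hL : L ∈ P.lines) (hx : x ∉ L) :
    #L + #{ℓ ∈ P.pencil x | Disjoint L ℓ} = #(P.pencil x) := by
  have := card_filter_add_card_filter_not (s := P.pencil x) (fun ℓ => Disjoint L ℓ)
  rw [card_filter_pencil hL hx] at this
  omega

lemma card_le_card_pencil (hL : L ∈ P.lines) (hx : x ∉ L) : #L ≤ #(P.pencil x) := by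
  have := card_filter_pencil_disjoint hL hx
  omega

/-- A point off `L` on only `#L` lines is on no line that misses `L`. -/
lemma not_disjoint_of_card (hL : L ∈ P.lines) (hx : x ∉ L) (h : #(P.pencil x) ≤ #L)
    (hℓ : ℓ ∈ P.lines) (hxℓ : x ∈ ℓ) : ¬ Disjoint L ℓ := by
  intro hd
  have h1 := card_filter_pencil_disjoint hL hx
  have h2 : 0 < #{ℓ ∈ P.pencil x | Disjoint L ℓ} :=
    card_pos.2 ⟨ℓ, mem_filter.2 ⟨mem_pencil.2 ⟨hℓ, hxℓ⟩, hd⟩⟩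
  omega

/-- A point on at most `#L + 1` lines is on at most one line that misses `L`. -/
lemma eq_of_missing (hL : L ∈ P.lines) (h : #(P.pencil x) ≤ #L + 1)
    (hℓ : ℓ ∈ P.missing L) (hm : m ∈ P.missing L) (hxℓ : x ∈ ℓ) (hxm : x ∈ m) : ℓ = m := by
  rw [mem_missing] at hℓ hm
  have hx : x ∉ L := fun hx => Finset.disjoint_left.1 hℓ.2 hx hxℓ
  have h1 := card_filter_pencil_disjoint hL hx
  have h2 : #{ℓ ∈ P.pencil x | Disjoint L ℓ} ≤ 1 := by omega
  exact card_le_one.1 h2 ℓ (mem_filter.2 ⟨mem_pencil.2 ⟨hℓ.1, hxℓ⟩, hℓ.2⟩) m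
    (mem_filter.2 ⟨mem_pencil.2 ⟨hm.1, hxm⟩, hm.2⟩)

/-- Every line other than `L` either misses `L` or passes through exactly one point of `L`. -/
lemma card_lines_eq_sum (hL : L ∈ P.lines) :
    #P.lines = 1 + ∑ x ∈ L, (#(P.pencil x) - 1) + #(P.missing L) := by
  have h1 : P.lines.filter (¬ Disjoint L ·) =
      insert L (L.biUnion fun x => (P.pencil x).erase L) := by
    ext ℓ
    simp only [mem_filter, mem_insert, mem_biUnion, mem_erase, mem_pencil,
      Finset.not_disjoint_iff]
    constructor
    · rintro ⟨h1, x, h2, h3⟩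
      by_cases h : ℓ = L
      · exact Or.inl h
      · exact Or.inr ⟨x, h2, h, h1, h3⟩
    · rintro (rfl | ⟨x, h1, h2, h3, h4⟩)
      · have := P.two_le_card _ hL
        obtain ⟨x, hx⟩ : ℓ.Nonempty := card_pos.1 (by omega)
        exact ⟨hL, x, hx, hx⟩
      · exact ⟨h3, x, h1, h4⟩
  have h2 : #(P.lines.filter (¬ Disjoint L ·)) = 1 + ∑ x ∈ L, (#(P.pencil x) - 1) := by
    rw [h1, card_insert_of_notMem, card_biUnion, add_comm]
    · congr 1
      refine sum_congr rfl fun x hx => ?_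
      rw [card_erase_of_mem (mem_pencil.2 ⟨hL, hx⟩)]
    · intro x hx y hy hxy
      change Disjoint _ _
      rw [Finset.disjoint_left]
      intro ℓ h1 h2
      rw [mem_erase, mem_pencil] at h1 h2
      exact hxy (eq_of_mem h1.2.1 hL h1.1 h1.2.2 h2.2.2 hx hy)
    · simp
  have h3 := card_filter_add_card_filter_not (s := P.lines) (fun ℓ => Disjoint L ℓ)
  have h4 : #(P.missing L) = #{ℓ ∈ P.lines | Disjoint L ℓ} := rfl
  omega

lemma card_pencil_pos (hL : L ∈ P.lines) (hx : x ∈ L) : 1 ≤ #(P.pencil x) :=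
  card_pos.2 ⟨L, mem_pencil.2 ⟨hL, hx⟩⟩

lemma card_le_of_avoid_nonempty {q : ℕ} (hdeg : ∀ x, #(P.pencil x) ≤ q + 1)
    (h : (P.avoid e).Nonempty) (hL : L ∈ P.lines) : #L ≤ q + 1 := by
  by_cases hx : ∃ x, x ∉ L
  · obtain ⟨x, hx⟩ := hx
    exact (card_le_card_pencil hL hx).trans (hdeg x)
  · push Not at hx
    obtain ⟨ℓ, hℓ⟩ := h
    rw [mem_avoid] at hℓ
    have h2 := P.two_le_card ℓ hℓ.1
    obtain ⟨a, ha, b, hb, hab⟩ := one_lt_card.1 (by omega : 1 < #ℓ)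
    exact absurd (P.line_unique ℓ hℓ.1 L hL a b hab ha hb (hx a) (hx b) ▸ hx e) hℓ.2

/-- A line with `q + 1` points meets every line, so that all lines are counted through its points.
-/
lemma card_avoid_le_of_long_line {q : ℕ} (hdeg : ∀ x, #(P.pencil x) ≤ q + 1) (e : V)
    (hL : L ∈ P.lines) (hLq : q + 1 ≤ #L) : #(P.avoid e) ≤ q ^ 2 := by
  rcases (P.avoid e).eq_empty_or_nonempty with h0 | h0
  · simp [h0]
  have hLc : #L = q + 1 := le_antisymm (card_le_of_avoid_nonempty hdeg h0 hL) hLq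
  have hD : P.missing L = ∅ := by
    rw [eq_empty_iff_forall_notMem]
    intro ℓ hℓ
    rw [mem_missing] at hℓ
    have := P.two_le_card ℓ hℓ.1
    obtain ⟨x, hx⟩ : ℓ.Nonempty := card_pos.1 (by omega)
    refine not_disjoint_of_card hL (fun hxL => Finset.disjoint_left.1 hℓ.2 hxL hx) ?_ hℓ.1 hx hℓ.2
    rw [hLc]; exact hdeg x
  have h1 := card_lines_eq_sum hL
  have h2 := P.card_lines_eq e
  rw [hD, card_empty] at h1
  by_cases he : e ∈ L
  · have h3 : ∑ x ∈ L.erase e, (#(P.pencil x) - 1) ≤ #(L.erase e) * q := by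
      rw [← smul_eq_mul]
      exact sum_le_card_nsmul _ _ _ fun x _ => by have := hdeg x; omega
    rw [card_erase_of_mem he, hLc] at h3
    have h4 := add_sum_erase L (fun x => #(P.pencil x) - 1) he
    have h5 := card_pencil_pos hL he
    have : (q + 1 - 1) * q = q ^ 2 := by rw [Nat.add_sub_cancel]; ring
    omega
  · have h3 : ∑ x ∈ L, (#(P.pencil x) - 1) ≤ #L * q := by
      rw [← smul_eq_mul]
      exact sum_le_card_nsmul _ _ _ fun x _ => by have := hdeg x; omega
    have h4 := card_le_card_pencil hL he
    rw [hLc] at h3 h4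
    have : (q + 1) * q = q ^ 2 + q := by ring
    omega

/-- The sum of `(#ℓ - 2) * (q - #ℓ) ≥ 0` over the lines `ℓ` that avoid `e`. -/
lemma card_avoid_mul_le {q : ℕ} (hdeg : ∀ x, #(P.pencil x) ≤ q + 1)
    (hsize : ∀ ℓ ∈ P.lines, #ℓ ≤ q) (e : V) :
    2 * q * (#(P.avoid e) : ℤ) ≤
      (Fintype.card V - 1) * ((q + 1) * q - (Fintype.card V - q)) := by
  calc 2 * q * (#(P.avoid e) : ℤ) = ∑ ℓ ∈ P.avoid e, (2 * q : ℤ) := by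
        rw [sum_const, nsmul_eq_mul]; ring
    _ ≤ ∑ ℓ ∈ P.avoid e, (#ℓ : ℤ) * ((q + 1) - ((#ℓ : ℤ) - 1)) := by
        refine sum_le_sum fun ℓ hℓ => ?_
        have h1 := P.two_le_card ℓ (mem_avoid.1 hℓ).1
        have h2 := hsize ℓ (mem_avoid.1 hℓ).1
        zify at h1 h2
        nlinarith
    _ = ∑ x ∈ univ.erase e,
          ((q + 1 : ℤ) * (#(P.pencil x) - 1) - (Fintype.card V - #(P.join e x))) := by
        rw [sum_avoid e fun ℓ => ((q + 1 : ℤ) - ((#ℓ : ℤ) - 1))]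
        exact sum_congr rfl fun x hx => sum_pencil_erase (ne_of_mem_erase hx) _
    _ ≤ ∑ x ∈ univ.erase e, ((q + 1 : ℤ) * q - (Fintype.card V - q)) := by
        refine sum_le_sum fun x hx => ?_
        have h1 := hdeg x
        have h2 := hsize _ (join_mem (P := P) (ne_of_mem_erase hx).symm)
        zify at h1 h2
        nlinarith
    _ = _ := by
        rw [sum_const, nsmul_eq_mul, cast_card_erase_of_mem (mem_univ e), card_univ]

lemma card_avoid_le_of_le_four {q : ℕ} (hq2 : 2 ≤ q) (hq4 : q ≤ 4)
    (hdeg : ∀ x, #(P.pencil x) ≤ q + 1) (e : V) : #(P.avoid e) ≤ q ^ 2 := by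
  by_cases h : ∃ L ∈ P.lines, q + 1 ≤ #L
  · obtain ⟨L, hL, hLq⟩ := h
    exact card_avoid_le_of_long_line hdeg e hL hLq
  · push Not at h
    have h1 := card_avoid_mul_le hdeg (fun ℓ hℓ => Nat.le_of_lt_succ (h ℓ hℓ)) e
    generalize hn : (Fintype.card V : ℤ) = n at h1
    zify
    by_contra! hB
    -- the quadratic in `n` is largest at `n = (q ^ 2 + 2 * q + 1) / 2`
    interval_cases q <;> push_cast at h1 hB <;>
      nlinarith [sq_nonneg (2 * n - 9), sq_nonneg (2 * n - 16), sq_nonneg (2 * n - 25)]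

/-- If five-point lines are pairwise disjoint, then fewer than `26` lines avoid `e`. The count is
based on `(#ℓ - 2) * (#ℓ - 4)`, which is at most `0` unless `ℓ` has five points; the excess `3` of a
five-point line is distributed over its points. Everything is scaled by `5` to stay in `ℤ`. -/
lemma exists_meeting_of_avoid (hdeg : ∀ x, #(P.pencil x) ≤ 6) (hsize : ∀ ℓ ∈ P.lines, #ℓ ≤ 5)
    (hB : 26 ≤ #(P.avoid e)) :
    ∃ L ∈ P.lines, ∃ M ∈ P.lines, #L = 5 ∧ #M = 5 ∧ L ≠ M ∧ ¬ Disjoint L M := by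
  by_contra! hno
  have key : 40 * (#(P.avoid e) : ℤ) ≤
      (Fintype.card V - 1) * (143 - 5 * (Fintype.card V - 1)) + 8 := by
    calc 40 * (#(P.avoid e) : ℤ) = ∑ ℓ ∈ P.avoid e, (40 : ℤ) := by
          rw [sum_const, nsmul_eq_mul]; ring
      _ ≤ ∑ ℓ ∈ P.avoid e, (#ℓ : ℤ) * (5 * (5 - ((#ℓ : ℤ) - 1)) + if #ℓ = 5 then 3 else 0) := by
          refine sum_le_sum fun ℓ hℓ => ?_
          have h1 := P.two_le_card ℓ (mem_avoid.1 hℓ).1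
          have h2 := hsize ℓ (mem_avoid.1 hℓ).1
          generalize #ℓ = c at h1 h2
          interval_cases c <;> norm_num
      _ = ∑ x ∈ univ.erase e, (5 * ((5 : ℤ) * (#(P.pencil x) - 1) -
            (Fintype.card V - #(P.join e x))) +
            ∑ ℓ ∈ (P.pencil x).erase (P.join e x), if #ℓ = 5 then (3 : ℤ) else 0) := by
          rw [sum_avoid e fun ℓ => (5 * (5 - ((#ℓ : ℤ) - 1)) + if #ℓ = 5 then 3 else 0)]
          refine sum_congr rfl fun x hx => ?_
          rw [sum_add_distrib, ← mul_sum, sum_pencil_erase (ne_of_mem_erase hx)]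
      _ ≤ ∑ x ∈ univ.erase e, ((143 - 5 * ((Fintype.card V : ℤ) - 1)) +
            if #(P.join e x) = 5 then 2 else 0) := by
          refine sum_le_sum fun x hx => ?_
          have hxe := ne_of_mem_erase hx
          have h1 := hdeg x
          have h2 := hsize _ (join_mem (P := P) hxe.symm)
          have h3 : (∑ ℓ ∈ (P.pencil x).erase (P.join e x), if #ℓ = 5 then (3 : ℤ) else 0) ≤
              if #(P.join e x) = 5 then 0 else 3 := by
            rw [← sum_filter, sum_const, nsmul_eq_mul]
            have hsub : ∀ ℓ ∈ ((P.pencil x).erase (P.join e x)).filter (#· = 5),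
                ℓ ∈ P.lines ∧ x ∈ ℓ ∧ #ℓ = 5 ∧ ℓ ≠ P.join e x := by
              intro ℓ hℓ
              rw [mem_filter, mem_erase, mem_pencil] at hℓ
              exact ⟨hℓ.1.2.1, hℓ.1.2.2, hℓ.2, hℓ.1.1⟩
            split_ifs with h5
            · have : ((P.pencil x).erase (P.join e x)).filter (#· = 5) = ∅ := by
                rw [eq_empty_iff_forall_notMem]
                intro ℓ hℓ
                obtain ⟨a, b, c, d⟩ := hsub ℓ hℓ
                exact Finset.disjoint_left.1 (hno ℓ a _ (join_mem hxe.symm) c h5 d) b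
                  (right_mem_join hxe.symm)
              simp [this]
            · have : #(((P.pencil x).erase (P.join e x)).filter (#· = 5)) ≤ 1 := by
                rw [card_le_one]
                intro ℓ hℓ m hm
                obtain ⟨a, b, c, d⟩ := hsub ℓ hℓ
                obtain ⟨a', b', c', d'⟩ := hsub m hm
                by_contra hne
                exact Finset.disjoint_left.1 (hno ℓ a m a' c c' hne) b b'
              have : (#(((P.pencil x).erase (P.join e x)).filter (#· = 5)) : ℤ) ≤ 1 := by
                exact_mod_cast this
              linarith
          have h4 : (#(P.pencil x) : ℤ) ≤ 6 := by exact_mod_cast h1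
          split_ifs at h3 ⊢ with h5
          · rw [h5]; push_cast; linarith
          · have : (#(P.join e x) : ℤ) ≤ 4 := by
              have : #(P.join e x) ≤ 4 := by omega
              exact_mod_cast this
            linarith
      _ ≤ _ := by
          rw [sum_add_distrib, sum_const, nsmul_eq_mul, cast_card_erase_of_mem (mem_univ e),
            card_univ, ← sum_filter, sum_const, nsmul_eq_mul]
          have : #((univ.erase e).filter fun x => #(P.join e x) = 5) ≤ 4 := by
            rcases ((univ.erase e).filter fun x => #(P.join e x) = 5).eq_empty_or_nonempty
              with h0 | ⟨x, hx⟩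
            · simp [h0]
            rw [mem_filter] at hx
            have hxe := ne_of_mem_erase hx.1
            have : (univ.erase e).filter (fun x => #(P.join e x) = 5) ⊆ (P.join e x).erase e := by
              intro y hy
              rw [mem_filter] at hy
              have hye := ne_of_mem_erase hy.1
              have : P.join e x = P.join e y := by
                by_contra hne
                exact Finset.disjoint_left.1 (hno _ (join_mem hxe.symm) _ (join_mem hye.symm)
                  hx.2 hy.2 hne) (left_mem_join hxe.symm) (left_mem_join hye.symm)
              rw [mem_erase, this]
              exact ⟨hye, right_mem_join hye.symm⟩
            refine (card_le_card this).trans ?_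
            rw [card_erase_of_mem (left_mem_join hxe.symm), hx.2]
          have : (#((univ.erase e).filter fun x => #(P.join e x) = 5) : ℤ) ≤ 4 := by
            exact_mod_cast this
          linarith
  generalize (Fintype.card V : ℤ) = n at key
  have hB' : (26 : ℤ) ≤ #(P.avoid e) := by exact_mod_cast hB
  nlinarith [sq_nonneg (10 * (n - 1) - 143)]

end LinearSpace
end LinesMatroid

namespace LinesMatroid

open Finset

namespace Word

lemma full_eq_one {g : Word → ℕ} {l : List Word} (h : ∀ s < 5, ∃ v ∈ l, g v = s) :
    full g l = 1 := by
  have key : ∀ s < 5, hasSym s g l = true := by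
    intro s hs
    obtain ⟨v, hv, hvs⟩ := h s hs
    exact List.any_eq_true.2 ⟨v, hv, by simp [hvs]⟩
  simp [full, key]

lemma agree_eq (u v : Word) : agree u v = (if u.c0 = v.c0 then 1 else 0) +
    (if u.c1 = v.c1 then 1 else 0) + (if u.c2 = v.c2 then 1 else 0) +
    (if u.c3 = v.c3 then 1 else 0) + (if u.c4 = v.c4 then 1 else 0) := by
  have key : ∀ a b : ℕ, (Nat.beq a b).toNat = if a = b then 1 else 0 := by
    intro a b
    by_cases h : a = b
    · subst h; simp
    · have : Nat.beq a b = false := by rw [Bool.eq_false_iff, Ne, Nat.beq_eq]; exact h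
      simp [this, h]
  simp only [agree, key]

end Word

/-! ### Encoding points by words -/

/-- A set of at most five elements can be labelled by different numbers less than five, with
prescribed elements `g a` for the labels `a ∈ A`. -/
lemma exists_labelling {β : Type*} [Fintype β] [DecidableEq β] {S : Finset β} (hS : #S ≤ 5)
    (hβ : 5 ≤ Fintype.card β) {A : Finset (Fin 5)} {g : Fin 5 → β} (hg : Set.InjOn g A)
    (hgS : ∀ a ∈ A, g a ∈ S) :
    ∃ φ : β → ℕ, Set.InjOn φ S ∧ (∀ s ∈ S, φ s < 5) ∧ (∀ a ∈ A, φ (g a) = a) ∧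
      (#S = 5 → ∀ k < 5, ∃ s ∈ S, φ s = k) := by
  obtain ⟨t, hSt, ht⟩ := exists_superset_card_eq hS hβ
  obtain ⟨ψ, hψ⟩ := Finset.exists_equiv_extend_of_card_eq (t := t) (by simp [ht])
    (s := A) (f := g) (by
      intro b hb
      obtain ⟨a, ha, rfl⟩ := mem_image.1 hb
      exact hSt (hgS a ha)) hg
  have hφ : ∀ b (hb : b ∈ t), (if h : b ∈ t then ((ψ.symm ⟨b, h⟩ : Fin 5) : ℕ) else 0) =
      (ψ.symm ⟨b, hb⟩ : Fin 5) := fun b hb => dif_pos hb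
  refine ⟨fun b => if h : b ∈ t then ((ψ.symm ⟨b, h⟩ : Fin 5) : ℕ) else 0, ?_, ?_, ?_, ?_⟩
  · intro b hb c hc hbc
    simp only at hbc
    rw [hφ b (hSt hb), hφ c (hSt hc)] at hbc
    have := ψ.symm.injective (Fin.ext hbc)
    exact congrArg Subtype.val this
  · intro b hb
    simp only
    rw [hφ b (hSt hb)]
    exact (ψ.symm _).2
  · intro a ha
    simp only
    rw [hφ _ (hSt (hgS a ha))]
    have : ψ.symm ⟨g a, hSt (hgS a ha)⟩ = a := by
      rw [Equiv.symm_apply_eq]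
      exact Subtype.ext (hψ a ha).symm
    rw [this]
  · intro h5 k hk
    have hSeq : S = t := eq_of_subset_of_card_le hSt (by omega)
    refine ⟨ψ ⟨k, hk⟩, hSeq ▸ (ψ ⟨k, hk⟩).2, ?_⟩
    simp only
    rw [hφ _ (ψ ⟨k, hk⟩).2]
    simp

lemma exists_labelling_three {β : Type*} [Fintype β] [DecidableEq β] {S : Finset β} (hS : #S ≤ 5)
    (hβ : 5 ≤ Fintype.card β) {b₀ b₁ b₂ : β} (h₀ : b₀ ∈ S) (h₁ : b₁ ∈ S) (h₂ : b₂ ∈ S)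
    (h₀₁ : b₀ ≠ b₁) (h₀₂ : b₀ ≠ b₂) (h₁₂ : b₁ ≠ b₂) :
    ∃ φ : β → ℕ, Set.InjOn φ S ∧ (∀ s ∈ S, φ s < 5) ∧ (φ b₀ = 0 ∧ φ b₁ = 1 ∧ φ b₂ = 2) ∧
      (#S = 5 → ∀ k < 5, ∃ s ∈ S, φ s = k) := by
  obtain ⟨φ, h4, h5, h6, h7⟩ := exists_labelling hS hβ (A := {0, 1, 2})
    (g := ![b₀, b₁, b₂, b₂, b₂]) (by
      intro i hi k hk hik
      simp only [coe_insert, coe_singleton, Set.mem_insert_iff, Set.mem_singleton_iff] at hi hk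
      rcases hi with rfl | rfl | rfl <;> rcases hk with rfl | rfl | rfl <;>
        simp_all [eq_comm]) (by simp [h₀, h₁, h₂])
  exact ⟨φ, h4, h5, ⟨by simpa using h6 0 (by simp), by simpa using h6 1 (by simp),
    by simpa using h6 2 (by simp)⟩, h7⟩

namespace LinearSpace

variable {V : Type*} [Fintype V] [DecidableEq V] {P : LinearSpace V} {L M : Finset V}

/-- The points off a five-point line `L` are encoded by words that agree in exactly one position if
their line meets `L`, and nowhere if it misses `L`. Here `M` is a second five-point line that
meets `L` in `p`, enumerated by `xs`, and `a`, `b` are points on a line that misses `L`. The point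
of `L` with index `i` is the one on the line through `a` and `xs i`. If a point of `L` is on six
lines then all five labels occur in its position. -/
theorem exists_words (hdeg : ∀ x, #(P.pencil x) ≤ 6) (hL : L ∈ P.lines) (hM : M ∈ P.lines)
    (hL5 : #L = 5) (hM5 : #M = 5) (hLM : L ≠ M) {p a b : V} (hpL : p ∈ L) (hpM : p ∈ M)
    (haL : a ∉ L) (haM : a ∉ M) (hbL : b ∉ L) (hbM : b ∉ M) (hab : a ≠ b)
    (hd : Disjoint L (P.join a b)) (hmeet : ∀ x ∈ M, x ∉ L → ¬ Disjoint L (P.join a x)) :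
    ∃ (xs : Fin 5 → V) (W : V → Word), Function.Injective xs ∧ (∀ i, xs i ∈ M) ∧ xs 0 = p ∧
      (∀ y ∉ L, W y ∈ Word.all) ∧
      (∀ y z, y ∉ L → z ∉ L → y ≠ z →
        Word.agree (W y) (W z) = if Disjoint L (P.join y z) then 0 else 1) ∧
      (∀ i, i ≠ 0 → W (xs i) = Word.pivot i) ∧ W a = Word.base ∧ (W b).c0 = 2 ∧
      (∀ T : List V, (∀ y ∉ L, y ∈ T) →
        #{x ∈ L | #(P.pencil x) = 6} ≤ Word.numFull (T.map W)) := by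
  have hne : ∀ {x y : V}, x ∈ L → y ∉ L → x ≠ y := by
    rintro x y hx hy rfl; exact hy hx
  have hneM : ∀ {x y : V}, x ∈ M → y ∉ M → x ≠ y := by
    rintro x y hx hy rfl; exact hy hx
  -- an enumeration of the points of `M`
  obtain ⟨ξ, hξ⟩ := Finset.exists_equiv_extend_of_card_eq (α := Fin 5) (t := M) (by simp [hM5])
    (s := {0}) (f := fun _ => p) (by simpa using hpM) (by simp)
  obtain ⟨xs, hxs⟩ : ∃ xs : Fin 5 → V, ∀ i, xs i = ξ i := ⟨_, fun _ => rfl⟩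
  have hinj : Function.Injective xs := by
    intro i j h
    rw [hxs, hxs] at h
    exact ξ.injective (Subtype.ext h)
  have hxM : ∀ i, xs i ∈ M := fun i => by rw [hxs]; exact (ξ i).2
  have hx0 : xs 0 = p := by rw [hxs]; exact hξ 0 (by simp)
  have hax : ∀ i, a ≠ xs i := fun i => (hneM (hxM i) haM).symm
  -- the point of `L` on the line through `a` and `xs i`
  have hf : ∀ i, ∃ v ∈ L, v ∈ P.join a (xs i) := by
    intro i
    by_cases h : xs i ∈ L
    · exact ⟨_, h, right_mem_join (hax i)⟩
    · obtain ⟨v, hv, hv'⟩ := Finset.not_disjoint_iff.1 (hmeet _ (hxM i) h)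
      exact ⟨v, hv, hv'⟩
  choose f hfL hfj using hf
  have hf0 : f 0 = p := by
    refine eq_of_mem (join_mem (hax 0)) hL ?_ (hfj 0) (hx0 ▸ right_mem_join (hax 0)) (hfL 0) hpL
    rintro h
    exact haL (h ▸ left_mem_join (hax 0))
  have hfinj : Function.Injective f := by
    intro i j hij
    by_contra hne'
    have h1 : P.join a (xs i) = P.join a (xs j) :=
      P.line_unique _ (join_mem (hax i)) _ (join_mem (hax j)) a (f i)
        (hne (hfL i) haL).symm (left_mem_join (hax i)) (hfj i) (left_mem_join (hax j))
        (hij ▸ hfj j)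
    have h2 : P.join a (xs i) = M :=
      P.line_unique _ (join_mem (hax i)) _ hM (xs i) (xs j) (hinj.ne hne')
        (right_mem_join (hax i)) (h1 ▸ right_mem_join (hax j)) (hxM i) (hxM j)
    exact haM (h2 ▸ left_mem_join (hax i))
  have hfimg : univ.image f = L := by
    refine eq_of_subset_of_card_le ?_ ?_
    · intro v hv
      obtain ⟨i, -, rfl⟩ := mem_image.1 hv
      exact hfL i
    · rw [card_image_of_injective _ hfinj, hL5]; simp
  have hfM : ∀ i, f i ∈ M → i = 0 := by
    intro i hi
    apply hfinj
    rw [hf0]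
    exact eq_of_mem hL hM hLM (hfL i) hpL hi hpM
  have hxL : ∀ i, xs i ∈ L → i = 0 := by
    intro i hi
    apply hinj
    rw [hx0]
    exact eq_of_mem hL hM hLM hi hpL (hxM i) hpM
  have hcard : 5 ≤ Fintype.card (Finset V) := by
    rw [Fintype.card_finset]
    have : 5 ≤ Fintype.card V := hL5 ▸ card_le_univ L
    calc 5 ≤ 2 ^ 5 := by norm_num
      _ ≤ _ := Nat.pow_le_pow_right (by norm_num) this
  have hmem : ∀ j {y}, y ∉ L → P.join (f j) y ∈ (P.pencil (f j)).erase L := by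
    intro j y hy
    have := hne (hfL j) hy
    rw [mem_erase, mem_pencil]
    exact ⟨fun h => hy (h ▸ right_mem_join this), join_mem this, left_mem_join this⟩
  have hS : ∀ j, #((P.pencil (f j)).erase L) ≤ 5 := by
    intro j
    rw [card_erase_of_mem (mem_pencil.2 ⟨hL, hfL j⟩)]
    have := hdeg (f j); omega
  -- labels of the lines through `f j`
  have hlab : ∀ j, ∃ φ : Finset V → ℕ, Set.InjOn φ ((P.pencil (f j)).erase L) ∧
      (∀ s ∈ (P.pencil (f j)).erase L, φ s < 5) ∧
      (#((P.pencil (f j)).erase L) = 5 → ∀ k < 5, ∃ s ∈ (P.pencil (f j)).erase L, φ s = k) ∧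
      (j = 0 → φ M = 0 ∧ φ (P.join (f j) a) = 1 ∧ φ (P.join (f j) b) = 2) ∧
      (j ≠ 0 → ∀ k, k ≠ 0 → φ (P.join (f j) (xs k)) = k) := by
    intro j
    by_cases hj : j = 0
    · subst hj
      have h1 : P.join (f 0) a ≠ M := fun h => haM (h ▸ right_mem_join (hne (hfL 0) haL))
      have h2 : P.join (f 0) b ≠ M := fun h => hbM (h ▸ right_mem_join (hne (hfL 0) hbL))
      have h3 : P.join (f 0) a ≠ P.join (f 0) b := by
        intro h
        have h4 := eq_join (P := P) hab (join_mem (hne (hfL 0) haL))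
          (right_mem_join (hne (hfL 0) haL)) (h ▸ right_mem_join (hne (hfL 0) hbL))
        exact Finset.disjoint_left.1 hd (hfL 0) (h4 ▸ left_mem_join (hne (hfL 0) haL))
      have h4 : M ∈ (P.pencil (f 0)).erase L :=
        mem_erase.2 ⟨hLM.symm, mem_pencil.2 ⟨hM, hf0 ▸ hpM⟩⟩
      obtain ⟨φ, h5, h6, h7, h8⟩ := exists_labelling_three (hS 0) hcard h4 (hmem 0 haL)
        (hmem 0 hbL) h1.symm h2.symm h3
      exact ⟨φ, h5, h6, h8, fun _ => h7, fun h => absurd rfl h⟩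
    · obtain ⟨φ, h4, h5, h6, h7⟩ := exists_labelling (hS j) hcard (A := univ.erase 0)
        (g := fun k => P.join (f j) (xs k)) (by
          intro k hk l hl hkl
          have hk' : xs k ∉ L := fun h => by simp [hxL k h] at hk
          have hl' : xs l ∉ L := fun h => by simp [hxL l h] at hl
          by_contra hkl'
          simp only at hkl
          have h1 : P.join (f j) (xs k) = M :=
            P.line_unique _ (join_mem (hne (hfL j) hk')) _ hM (xs k) (xs l) (hinj.ne hkl')
              (right_mem_join (hne (hfL j) hk'))
              (hkl ▸ right_mem_join (hne (hfL j) hl')) (hxM k) (hxM l)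
          exact hj (hfM j (h1 ▸ left_mem_join (hne (hfL j) hk')))) (by
          intro k hk
          exact hmem j fun h => by simp [hxL k h] at hk)
      exact ⟨φ, h4, h5, h7, fun h => absurd h hj, fun _ k hk => h6 k (by simp [hk])⟩
  choose φ hφinj hφlt hφsurj hφ0 hφ1 using hlab
  obtain ⟨sym, hsym⟩ : ∃ sym : Fin 5 → V → ℕ, ∀ j y, sym j y = φ j (P.join (f j) y) :=
    ⟨_, fun _ _ => rfl⟩
  -- two points have the same symbol at `j` exactly if their line passes through `f j`
  have hsymeq : ∀ j {y z}, y ∉ L → z ∉ L → y ≠ z →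
      (sym j y = sym j z ↔ f j ∈ P.join y z) := by
    intro j y z hy hz hyz
    have hjy := hne (hfL j) hy
    have hjz := hne (hfL j) hz
    rw [hsym, hsym]
    constructor
    · intro h
      have h1 := hφinj j (mem_coe.2 (hmem j hy)) (mem_coe.2 (hmem j hz)) h
      have h2 := eq_join (P := P) hyz (join_mem hjy) (right_mem_join hjy)
        (h1 ▸ right_mem_join hjz)
      exact h2 ▸ left_mem_join hjy
    · intro h
      rw [← eq_join hjy (join_mem hyz) h (left_mem_join hyz),
        ← eq_join hjz (join_mem hyz) h (right_mem_join hyz)]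
  have hsymx : ∀ j k, k ≠ 0 → sym j (xs k) = if j = 0 then 0 else (k : ℕ) := by
    intro j k hk
    rw [hsym]
    split_ifs with hj
    · subst hj
      have hk' : xs k ∉ L := fun h => hk (hxL k h)
      rw [← eq_join (P := P) (hne (hfL 0) hk') hM (hf0 ▸ hpM) (hxM k)]
      exact (hφ0 0 rfl).1
    · exact hφ1 j hj k hk
  have hsyma : ∀ j, j ≠ 0 → sym j a = j := by
    intro j hj
    have hj' : xs j ∉ L := fun h => hj (hxL j h)
    rw [hsym, ← eq_join (P := P) (hne (hfL j) haL) (join_mem (hax j)) (hfj j)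
      (left_mem_join (hax j)), eq_join (P := P) (hne (hfL j) hj') (join_mem (hax j)) (hfj j)
      (right_mem_join (hax j))]
    exact hφ1 j hj j hj
  refine ⟨xs, fun y => ⟨sym 0 y, sym 1 y, sym 2 y, sym 3 y, sym 4 y⟩, hinj, hxM, hx0,
    ?_, ?_, ?_, ?_, ?_, ?_⟩
  · intro y hy
    have h : ∀ j, sym j y < 5 := fun j => by rw [hsym]; exact hφlt j _ (hmem j hy)
    exact Word.mem_all (h 0) (h 1) (h 2) (h 3) (h 4)
  · intro y z hy hz hyz
    rw [Word.agree_eq]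
    simp only [hsymeq _ hy hz hyz]
    have h1 := Fin.sum_univ_five fun j => if f j ∈ P.join y z then 1 else 0
    rw [← h1]
    split_ifs with hdis
    · refine sum_eq_zero fun j _ => if_neg fun h => Finset.disjoint_left.1 hdis (hfL j) h
    · obtain ⟨v, hvL, hv⟩ := Finset.not_disjoint_iff.1 hdis
      rw [← hfimg] at hvL
      obtain ⟨i, -, rfl⟩ := mem_image.1 hvL
      have h2 : ∀ j, (if f j ∈ P.join y z then 1 else 0) = if j = i then 1 else 0 := by
        intro j
        refine if_congr ⟨fun h => hfinj ?_, fun h => h ▸ hv⟩ rfl rfl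
        refine eq_of_mem (join_mem hyz) hL ?_ h hv (hfL j) (hfL i)
        intro h3
        exact hy (h3 ▸ left_mem_join hyz)
      simp [h2]
  · intro i hi
    simp [hsymx _ _ hi, Word.pivot]
  · have h0 : sym 0 a = 1 := by rw [hsym]; exact (hφ0 0 rfl).2.1
    simp [Word.base, h0, hsyma]
  · simp only
    rw [hsym]; exact (hφ0 0 rfl).2.2
  · intro T hT
    have h1 : ∀ j (g : Word → ℕ), (∀ y, g ⟨sym 0 y, sym 1 y, sym 2 y, sym 3 y, sym 4 y⟩ = sym j y) →
        (if #(P.pencil (f j)) = 6 then 1 else 0) ≤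
        Word.full g (T.map fun y => ⟨sym 0 y, sym 1 y, sym 2 y, sym 3 y, sym 4 y⟩) := by
      intro j g hg
      split_ifs with h6
      · rw [Word.full_eq_one]
        intro s hs
        obtain ⟨ℓ, hℓ, hℓs⟩ := hφsurj j (by
          rw [card_erase_of_mem (mem_pencil.2 ⟨hL, hfL j⟩), h6]) s hs
        rw [mem_erase, mem_pencil] at hℓ
        obtain ⟨y, hy, hyf⟩ := exists_mem_ne (P.two_le_card ℓ hℓ.2.1) (f j)
        have hyL : y ∉ L := fun h => hyf (eq_of_mem hℓ.2.1 hL hℓ.1 hy hℓ.2.2 h (hfL j))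
        refine ⟨_, List.mem_map.2 ⟨y, hT y hyL, rfl⟩, ?_⟩
        rw [hg, hsym, ← eq_join hyf.symm hℓ.2.1 hℓ.2.2 hy, hℓs]
      · exact Nat.zero_le _
    have h2 : #{x ∈ L | #(P.pencil x) = 6} = ∑ j, if #(P.pencil (f j)) = 6 then 1 else 0 := by
      rw [card_filter, ← hfimg, sum_image fun i _ j _ h => hfinj h]
    rw [h2, Fin.sum_univ_five, Word.numFull]
    exact add_le_add (add_le_add (add_le_add (add_le_add (h1 0 Word.c0 fun _ => rfl)
      (h1 1 Word.c1 fun _ => rfl)) (h1 2 Word.c2 fun _ => rfl)) (h1 3 Word.c3 fun _ => rfl))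
      (h1 4 Word.c4 fun _ => rfl)

end LinearSpace
end LinesMatroid

namespace LinesMatroid

open Finset

namespace LinearSpace

variable {V : Type*} [Fintype V] [DecidableEq V] {P : LinearSpace V} {L M : Finset V}

/-- An encoding `W` of the points off `L` by words as in `exists_words`, where `xs` enumerates the
points of `M`, the one with index `0` being on `L`, and `a` and `b` are points with normalized
words. -/
structure Coding (P : LinearSpace V) (L M : Finset V) (a b : V) where
  xs : Fin 5 → V
  W : V → Word
  xs_mem : ∀ i, xs i ∈ M
  xs_notMem : ∀ i, i ≠ 0 → xs i ∉ L
  xs_ne : ∀ i j, i ≠ j → xs i ≠ xs j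
  surj : ∀ x ∈ M, x ∉ L → ∃ i, i ≠ 0 ∧ xs i = x
  mem_all : ∀ y ∉ L, W y ∈ Word.all
  agree_one : ∀ y z, y ∉ L → z ∉ L → y ≠ z → ¬ Disjoint L (P.join y z) → Word.agree (W y) (W z) = 1
  agree_zero : ∀ y z, y ∉ L → z ∉ L → y ≠ z → Disjoint L (P.join y z) → Word.agree (W y) (W z) = 0
  W_xs : ∀ i, i ≠ 0 → W (xs i) = Word.pivot i
  W_a : W a = Word.base
  W_b : (W b).c0 = 2
  le_numFull : ∀ T : List V, (∀ y ∉ L, y ∈ T) →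
    #{x ∈ L | #(P.pencil x) = 6} ≤ Word.numFull (T.map W)

lemma exists_coding (hdeg : ∀ x, #(P.pencil x) ≤ 6) (hL : L ∈ P.lines) (hM : M ∈ P.lines)
    (hL5 : #L = 5) (hM5 : #M = 5) (hLM : L ≠ M) (hmeet : ¬ Disjoint L M) {C : Finset V}
    (hC : C ∈ P.missing L) (hCM : Disjoint M C) {a b : V} (ha : a ∈ C) (hb : b ∈ C)
    (hab : a ≠ b) : Nonempty (Coding P L M a b) := by
  obtain ⟨p, hpL, hpM⟩ := Finset.not_disjoint_iff.1 hmeet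
  have hC' := mem_missing.1 hC
  have hnL : ∀ {y}, y ∈ C → y ∉ L := fun hy h => Finset.disjoint_left.1 hC'.2 h hy
  have hnM : ∀ {y}, y ∈ C → y ∉ M := fun hy h => Finset.disjoint_left.1 hCM h hy
  obtain ⟨xs, W, h1, h2, h3, h4, h5, h6, h7, h8, h9⟩ := exists_words hdeg hL hM hL5 hM5 hLM hpL hpM
    (hnL ha) (hnM ha) (hnL hb) (hnM hb) hab (by rw [← eq_join hab hC'.1 ha hb]; exact hC'.2) (by
      intro x hxM hxL hd
      have hax : a ≠ x := by rintro rfl; exact hnM ha hxM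
      have : P.join a x = C := eq_of_missing hL (by rw [hL5]; exact hdeg a)
        (mem_missing.2 ⟨join_mem hax, hd⟩) hC (left_mem_join hax) ha
      exact hnM (this ▸ right_mem_join hax) hxM)
  refine ⟨⟨xs, W, h2, fun i hi h => hi (h1 ?_), fun i j hij h => hij (h1 h), ?_, h4,
    fun y z hy hz hyz hd => ?_, fun y z hy hz hyz hd => ?_, h6, h7, h8, h9⟩⟩
  · rw [h3]
    exact eq_of_mem hL hM hLM h hpL (h2 i) hpM
  · have himg : univ.image xs = M := by
      refine eq_of_subset_of_card_le ?_ ?_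
      · intro v hv
        obtain ⟨i, -, rfl⟩ := mem_image.1 hv
        exact h2 i
      · rw [card_image_of_injective _ h1, hM5]; simp
    intro x hxM hxL
    rw [← himg] at hxM
    obtain ⟨i, -, rfl⟩ := mem_image.1 hxM
    refine ⟨i, ?_, rfl⟩
    rintro rfl
    exact hxL (h3 ▸ hpL)
  · rw [h5 y z hy hz hyz, if_neg hd]
  · rw [h5 y z hy hz hyz, if_pos hd]

namespace Coding

variable {a b : V} {C C' : Finset V} (K : Coding P L M a b)

lemma agree_of_mem (hL : L ∈ P.lines) (hL5 : #L = 5) (hdeg : ∀ x, #(P.pencil x) ≤ 6)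
    (hC : C ∈ P.missing L) {y z : V} (hy : y ∈ C) (hz : z ∉ L) (hzC : z ∉ C) :
    Word.agree (K.W y) (K.W z) = 1 ∧ Word.agree (K.W z) (K.W y) = 1 := by
  have hC' := mem_missing.1 hC
  have hyL : y ∉ L := fun h => Finset.disjoint_left.1 hC'.2 h hy
  have hyz : y ≠ z := by rintro rfl; exact hzC hy
  have h1 : ¬ Disjoint L (P.join y z) := by
    intro hd
    have : P.join y z = C := eq_of_missing hL (by rw [hL5]; exact hdeg y)
        (mem_missing.2 ⟨join_mem hyz, hd⟩) hC (left_mem_join hyz) hy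
    exact hzC (this ▸ right_mem_join hyz)
  exact ⟨K.agree_one y z hyL hz hyz h1, K.agree_one z y hz hyL hyz.symm (by rwa [join_comm])⟩

lemma agree_of_mem_of_mem (hC : C ∈ P.missing L) {y z : V} (hy : y ∈ C) (hz : z ∈ C)
    (hyz : y ≠ z) : Word.agree (K.W y) (K.W z) = 0 := by
  have hC' := mem_missing.1 hC
  exact K.agree_zero y z (fun h => Finset.disjoint_left.1 hC'.2 h hy)
    (fun h => Finset.disjoint_left.1 hC'.2 h hz) hyz
    (by rw [← eq_join hyz hC'.1 hy hz]; exact hC'.2)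

lemma exists_index {i : ℕ} (hi : i ∈ Finset.Icc 1 4) :
    ∃ k : Fin 5, k ≠ 0 ∧ (k : ℕ) = i ∧ K.W (K.xs k) = Word.pivot i := by
  rw [Finset.mem_Icc] at hi
  have hk : (⟨i, by omega⟩ : Fin 5) ≠ 0 := by
    intro h
    have := congrArg Fin.val h
    simp at this
    omega
  exact ⟨_, hk, rfl, K.W_xs _ hk⟩

lemma mem_candUnpaired {z : V} (hz : z ∉ L)
    (h : ∀ i, i ≠ 0 → Word.agree (K.W (K.xs i)) (K.W z) = 1) : K.W z ∈ Word.candUnpaired := by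
  refine Word.mem_candUnpaired (K.mem_all z hz) fun i hi => ?_
  obtain ⟨k, hk, -, hkW⟩ := K.exists_index hi
  rw [← hkW]
  exact h k hk

end Coding

end LinearSpace
end LinesMatroid

namespace LinesMatroid

open Finset

namespace LinearSpace

variable {V : Type*} [Fintype V] [DecidableEq V] {P : LinearSpace V} {L M : Finset V}

/-! ### Degrees at most six -/

/-- At most four lines that miss `L` meet `M`, and if there are four then each of the four points of
`M` off `L` is on one of them. -/
lemma card_missing_filter_le (hdeg : ∀ x, #(P.pencil x) ≤ 6) (hL : L ∈ P.lines) (hL5 : #L = 5)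
    (hM5 : #M = 5) (hmeet : ¬ Disjoint L M) :
    #{C ∈ P.missing L | ¬ Disjoint M C} ≤ 4 ∧
    (4 ≤ #{C ∈ P.missing L | ¬ Disjoint M C} → ∀ x ∈ M, x ∉ L → ∃ C ∈ P.missing L, x ∈ C) := by
  classical
  obtain ⟨p, hpL, hpM⟩ := Finset.not_disjoint_iff.1 hmeet
  obtain ⟨c, hc⟩ : ∃ c : V → Finset V, ∀ x, ∀ C ∈ P.missing L, x ∈ C → c x = C := by
    refine ⟨fun x => if h : ∃ C ∈ P.missing L, x ∈ C then h.choose else ∅, fun x C hC hx => ?_⟩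
    have h : ∃ C ∈ P.missing L, x ∈ C := ⟨C, hC, hx⟩
    simp only [dif_pos h]
    exact eq_of_missing hL (by rw [hL5]; exact hdeg x) h.choose_spec.1 hC h.choose_spec.2 hx
  have hsub : {C ∈ P.missing L | ¬ Disjoint M C} ⊆
      ((M.erase p).filter fun x => ∃ C ∈ P.missing L, x ∈ C).image c := by
    intro C hC
    rw [mem_filter, Finset.not_disjoint_iff] at hC
    obtain ⟨hC, x, hxM, hxC⟩ := hC
    rw [mem_image]
    refine ⟨x, mem_filter.2 ⟨mem_erase.2 ⟨?_, hxM⟩, C, hC, hxC⟩, hc x C hC hxC⟩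
    rintro rfl
    exact Finset.disjoint_left.1 (mem_missing.1 hC).2 hpL hxC
  have h1 := (card_le_card hsub).trans card_image_le
  have h2 : #(M.erase p) = 4 := by rw [card_erase_of_mem hpM, hM5]
  refine ⟨h1.trans ((card_filter_le _ _).trans h2.le), fun h4 x hxM hxL => ?_⟩
  have h3 : (M.erase p).filter (fun x => ∃ C ∈ P.missing L, x ∈ C) = M.erase p :=
    eq_of_subset_of_card_le (filter_subset _ _) (by omega)
  have h5 : x ∈ M.erase p := mem_erase.2 ⟨by rintro rfl; exact hxL hpL, hxM⟩
  rw [← h3] at h5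
  exact (mem_filter.1 h5).2

/-- Two meeting five-point lines `L` and `M` such that at least six lines miss `L` cannot exist,
under an extra condition on the points of `L` if exactly six lines miss `L`. Two lines that miss `L`
miss `M` too. By the search these are the only ones, so exactly six lines miss `L`, each of them has
two points, and together they contain all points off `L`; but then at most three points of `L` can
be on six lines. -/
theorem false_of_six_missing (hdeg : ∀ x, #(P.pencil x) ≤ 6) (hL : L ∈ P.lines)
    (hM : M ∈ P.lines) (hL5 : #L = 5) (hM5 : #M = 5) (hLM : L ≠ M) (hmeet : ¬ Disjoint L M)
    (h6 : 6 ≤ #(P.missing L))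
    (hF : #(P.missing L) = 6 → 4 ≤ #{x ∈ L | #(P.pencil x) = 6}) : False := by
  obtain ⟨hle, hall⟩ := card_missing_filter_le hdeg hL hL5 hM5 hmeet
  have hsum := card_filter_add_card_filter_not (s := P.missing L) (fun C => Disjoint M C)
  obtain ⟨C₅, hC₅, C₆, hC₆, h56⟩ :=
    one_lt_card.1 (by omega : 1 < #{C ∈ P.missing L | Disjoint M C})
  rw [mem_filter] at hC₅ hC₆
  obtain ⟨hC₅, hM₅⟩ := hC₅
  obtain ⟨hC₆, hM₆⟩ := hC₆
  obtain ⟨a, ha, b, hb, hab⟩ := one_lt_card.1 (P.two_le_card C₅ (mem_missing.1 hC₅).1)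
  obtain ⟨u, hu, v, hv, huv⟩ := one_lt_card.1 (P.two_le_card C₆ (mem_missing.1 hC₆).1)
  obtain ⟨K⟩ := exists_coding hdeg hL hM hL5 hM5 hLM hmeet hC₅ hM₅ ha hb hab
  have huniq : ∀ {x : V} {C D : Finset V}, C ∈ P.missing L → D ∈ P.missing L → x ∈ C → x ∈ D →
      C = D := fun {x C D} hC hD hx hx' =>
    eq_of_missing hL (by rw [hL5]; exact hdeg x) hC hD hx hx'
  have hnL : ∀ {x : V} {C : Finset V}, C ∈ P.missing L → x ∈ C → x ∉ L :=
    fun hC hx h => Finset.disjoint_left.1 (mem_missing.1 hC).2 h hx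
  have hagree : ∀ {C D : Finset V} {y z : V}, C ∈ P.missing L → D ∈ P.missing L → C ≠ D → y ∈ C →
      z ∈ D → Word.agree (K.W y) (K.W z) = 1 := fun hC hD hne hy hz =>
    (K.agree_of_mem hL hL5 hdeg hC hy (hnL hD hz) fun h => hne (huniq hC hD h hz)).1
  have hagree_zero : ∀ {C : Finset V} {y z : V}, C ∈ P.missing L → y ∈ C → z ∈ C → y ≠ z →
      Word.agree (K.W y) (K.W z) = 0 := fun hC hy hz hyz => K.agree_of_mem_of_mem hC hy hz hyz
  have hP : ∀ {C : Finset V} {y : V}, C ∈ P.missing L → Disjoint M C → y ∈ C →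
      K.W y ∈ Word.candUnpaired := fun hC hMC hy => K.mem_candUnpaired (hnL hC hy) fun i hi =>
    (K.agree_of_mem hL hL5 hdeg hC hy (K.xs_notMem i hi)
      (Finset.disjoint_left.1 hMC (K.xs_mem i))).2
  have h5b : Word.agree Word.base (K.W b) = 0 := K.W_a ▸ hagree_zero hC₅ ha hb hab
  have h5u : Word.agree Word.base (K.W u) = 1 := K.W_a ▸ hagree hC₅ hC₆ h56 ha hu
  have h5v : Word.agree Word.base (K.W v) = 1 := K.W_a ▸ hagree hC₅ hC₆ h56 ha hv
  obtain ⟨⟨hz1, hz2, hz3⟩, hleaf⟩ := (Word.search_spec (hP hC₅ hM₅ hb) h5b K.W_b (hP hC₆ hM₆ hu) h5u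
    (hagree hC₅ hC₆ h56 hb hu)).2 (K.W v) (hP hC₆ hM₆ hv) h5v (hagree hC₅ hC₆ h56 hb hv)
    (hagree_zero hC₆ hu hv huv)
  -- only two of the lines that miss `L` miss `M` as well
  have honly : ∀ C ∈ P.missing L, Disjoint M C → C = C₅ ∨ C = C₆ := by
    intro C hC hMC
    by_contra! hne
    obtain ⟨z, hz, -⟩ := one_lt_card.1 (P.two_le_card C (mem_missing.1 hC).1)
    exact hz1 _ (hP hC hMC hz) (K.W_a ▸ hagree hC₅ hC hne.1.symm ha hz)
      (hagree hC₅ hC hne.1.symm hb hz) (hagree hC₆ hC hne.2.symm hu hz)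
      (hagree hC₆ hC hne.2.symm hv hz)
  have hle2 : #{C ∈ P.missing L | Disjoint M C} ≤ 2 := by
    refine (card_le_card (t := {C₅, C₆}) fun C hC => ?_).trans card_le_two
    rw [mem_filter] at hC
    simpa using honly C hC.1 hC.2
  have hpart : ∀ i, ∃ (C : Finset V) (y : V), i ≠ 0 →
      C ∈ P.missing L ∧ K.xs i ∈ C ∧ y ∈ C ∧ y ≠ K.xs i := by
    intro i
    by_cases hi : i = 0
    · exact ⟨∅, a, fun h => absurd hi h⟩
    · obtain ⟨C, hC, hx⟩ := hall (by omega) (K.xs i) (K.xs_mem i) (K.xs_notMem i hi)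
      obtain ⟨y, hy, hyx⟩ := exists_mem_ne (P.two_le_card C (mem_missing.1 hC).1) (K.xs i)
      exact ⟨C, y, fun _ => ⟨hC, hx, hy, hyx⟩⟩
  choose C y hCy using hpart
  have hCm : ∀ i, i ≠ 0 → C i ∈ P.missing L := fun i hi => (hCy i hi).1
  have hCx : ∀ i, i ≠ 0 → K.xs i ∈ C i := fun i hi => (hCy i hi).2.1
  have hyC : ∀ i, i ≠ 0 → y i ∈ C i := fun i hi => (hCy i hi).2.2.1
  have hyx : ∀ i, i ≠ 0 → y i ≠ K.xs i := fun i hi => (hCy i hi).2.2.2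
  have hCne : ∀ i j, i ≠ 0 → j ≠ 0 → i ≠ j → C i ≠ C j := by
    intro i j hi hj hij h
    have : C i = M := P.line_unique _ (mem_missing.1 (hCm i hi)).1 _ hM _ _ (K.xs_ne i j hij)
      (hCx i hi) (h ▸ hCx j hj) (K.xs_mem i) (K.xs_mem j)
    exact hmeet (this ▸ (mem_missing.1 (hCm i hi)).2)
  have hC5 : ∀ i, i ≠ 0 → C₅ ≠ C i := fun i hi h =>
    Finset.disjoint_left.1 hM₅ (K.xs_mem i) (h ▸ hCx i hi)
  have hC6 : ∀ i, i ≠ 0 → C₆ ≠ C i := fun i hi h =>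
    Finset.disjoint_left.1 hM₆ (K.xs_mem i) (h ▸ hCx i hi)
  have hQ : ∀ i : Fin 5, i ≠ 0 → ∀ z ∈ C i, z ≠ K.xs i → K.W z ∈
      Word.select (K.W v) 1
        (Word.select (K.W u) 1 (Word.select (K.W b) 1 (Word.candPartner i))) := by
    intro i hi z hz hzx
    simp only [Word.mem_select]
    refine ⟨⟨⟨Word.mem_candPartner (K.mem_all z (hnL (hCm i hi) hz)) ?_ ?_, ?_⟩, ?_⟩, ?_⟩
    · intro j hj
      obtain ⟨k, hk, hkj, hkW⟩ := K.exists_index hj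
      rw [← hkW]
      split_ifs with hij
      · have : k = i := Fin.ext (hkj.trans hij.symm)
        subst this
        exact hagree_zero (hCm k hk) (hCx k hk) hz hzx.symm
      · have hne : k ≠ i := by rintro rfl; exact hij hkj
        exact hagree (hCm k hk) (hCm i hi) (hCne k i hk hi hne) (hCx k hk) hz
    · exact K.W_a ▸ hagree hC₅ (hCm i hi) (hC5 i hi) ha hz
    · exact hagree hC₅ (hCm i hi) (hC5 i hi) hb hz
    · exact hagree hC₆ (hCm i hi) (hC6 i hi) hu hz
    · exact hagree hC₆ (hCm i hi) (hC6 i hi) hv hz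
  have hQy : ∀ i : Fin 5, i ≠ 0 → K.W (y i) ∈
      Word.select (K.W v) 1 (Word.select (K.W u) 1 (Word.select (K.W b) 1 (Word.candPartner i))) :=
    fun i hi => hQ i hi _ (hyC i hi) (hyx i hi)
  have hyy : ∀ i j, i ≠ 0 → j ≠ 0 → i ≠ j → Word.agree (K.W (y i)) (K.W (y j)) = 1 :=
    fun i j hi hj hij => hagree (hCm i hi) (hCm j hj) (hCne i j hi hj hij) (hyC i hi) (hyC j hj)
  have h1 : (1 : Fin 5) ≠ 0 := by decide
  have h2 : (2 : Fin 5) ≠ 0 := by decide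
  have h3 : (3 : Fin 5) ≠ 0 := by decide
  have h4 : (4 : Fin 5) ≠ 0 := by decide
  have hfour : ∀ i : Fin 5, i ≠ 0 → i = 1 ∨ i = 2 ∨ i = 3 ∨ i = 4 := by decide
  obtain ⟨hfull, he1, he2, he3, he4⟩ := Word.pairCheck_spec hleaf (hQy 1 h1) (hQy 2 h2) (hQy 3 h3)
    (hQy 4 h4) (hyy 1 2 h1 h2 (by decide)) (hyy 1 3 h1 h3 (by decide))
    (hyy 1 4 h1 h4 (by decide)) (hyy 2 3 h2 h3 (by decide)) (hyy 2 4 h2 h4 (by decide))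
    (hyy 3 4 h3 h4 (by decide))
  -- each of these lines has only the two points already known
  have hCi : ∀ i, i ≠ 0 → ∀ z ∈ C i, z = K.xs i ∨ z = y i := by
    intro i hi z hz
    by_contra! hne
    have hzQ := hQ i hi z hz hne.1
    have hzi : Word.agree (K.W (y i)) (K.W z) = 0 := hagree_zero (hCm i hi) (hyC i hi) hz hne.2.symm
    have hzj : ∀ j, j ≠ 0 → j ≠ i → Word.agree (K.W (y j)) (K.W z) = 1 := fun j hj hji =>
      hagree (hCm j hj) (hCm i hi) (hCne j i hj hi hji) (hyC j hj) hz
    rcases hfour i hi with rfl | rfl | rfl | rfl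
    · exact Word.noExt_spec he1 hzQ hzi (hzj 2 h2 (by decide)) (hzj 3 h3 (by decide))
        (hzj 4 h4 (by decide))
    · exact Word.noExt_spec he2 hzQ hzi (hzj 1 h1 (by decide)) (hzj 3 h3 (by decide))
        (hzj 4 h4 (by decide))
    · exact Word.noExt_spec he3 hzQ hzi (hzj 1 h1 (by decide)) (hzj 2 h2 (by decide))
        (hzj 4 h4 (by decide))
    · exact Word.noExt_spec he4 hzQ hzi (hzj 1 h1 (by decide)) (hzj 2 h2 (by decide))
        (hzj 3 h3 (by decide))
  have hT : ∀ z ∉ L, z ∈ [y 1, y 2, y 3, y 4, K.xs 1, K.xs 2, K.xs 3, K.xs 4, a, b, u, v] := by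
    intro z hzL
    by_cases hz : ∃ D ∈ P.missing L, z ∈ D
    · obtain ⟨D, hD, hzD⟩ := hz
      by_cases hMD : Disjoint M D
      · rcases honly D hD hMD with rfl | rfl
        · by_cases hza : z = a
          · simp [hza]
          by_cases hzb : z = b
          · simp [hzb]
          exact absurd (hagree hC₆ hC₅ h56.symm hv hzD) (hz3 _ (hP hC₅ hM₅ hzD)
            (K.W_a ▸ hagree_zero hC₅ ha hzD (Ne.symm hza)) (hagree_zero hC₅ hb hzD (Ne.symm hzb))
            (hagree hC₆ hC₅ h56.symm hu hzD))
        · by_cases hzu : z = u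
          · simp [hzu]
          by_cases hzv : z = v
          · simp [hzv]
          exact absurd (hagree_zero hC₆ hv hzD (Ne.symm hzv)) (hz2 _ (hP hC₆ hM₆ hzD)
            (K.W_a ▸ hagree hC₅ hC₆ h56 ha hzD) (hagree hC₅ hC₆ h56 hb hzD)
            (hagree_zero hC₆ hu hzD (Ne.symm hzu)))
      · obtain ⟨x, hxM, hxD⟩ := Finset.not_disjoint_iff.1 hMD
        obtain ⟨i, hi, rfl⟩ := K.surj x hxM (hnL hD hxD)
        rw [huniq hD (hCm i hi) hxD (hCx i hi)] at hzD
        rcases hCi i hi z hzD with rfl | rfl <;>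
          rcases hfour i hi with rfl | rfl | rfl | rfl <;> simp
    · push Not at hz
      have hone : ∀ {D : Finset V} {w : V}, D ∈ P.missing L → w ∈ D →
          Word.agree (K.W w) (K.W z) = 1 := fun hD hw =>
        (K.agree_of_mem hL hL5 hdeg hD hw hzL (hz _ hD)).1
      exact absurd (hone hC₆ hv) (hz1 _
        (K.mem_candUnpaired hzL fun i hi => hone (hCm i hi) (hCx i hi))
        (K.W_a ▸ hone hC₅ ha) (hone hC₅ hb) (hone hC₆ hu))
  have hfin := K.le_numFull _ hT
  simp only [List.map_cons, List.map_nil, K.W_a, K.W_xs 1 h1, K.W_xs 2 h2, K.W_xs 3 h3,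
    K.W_xs 4 h4] at hfin
  have := hF (by omega)
  exact absurd (this.trans hfin) (by
    have h : Word.numFull _ ≤ 3 := hfull
    exact Nat.not_le.2 (Nat.lt_succ_of_le h))

/-- The exceptional configuration with five lines that miss `L`, none of them through `e`. As there
are at most ten points besides `e` off `L`, these lines are disjoint pairs, and the word of `e`
takes the role of the second pair in the search. -/
theorem false_of_five_missing (hdeg : ∀ x, #(P.pencil x) ≤ 6) (hL : L ∈ P.lines)
    (hM : M ∈ P.lines) (hL5 : #L = 5) (hM5 : #M = 5) (hLM : L ≠ M) (hmeet : ¬ Disjoint L M)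
    (h5 : #(P.missing L) = 5) (hF : 5 ≤ #{x ∈ L | #(P.pencil x) = 6}) {e : V} (heL : e ∉ L)
    (heM : e ∉ M) (he : #(P.pencil e) = 5) (hV : Fintype.card V ≤ 16) : False := by
  obtain ⟨hle, -⟩ := card_missing_filter_le hdeg hL hL5 hM5 hmeet
  have hsum := card_filter_add_card_filter_not (s := P.missing L) (fun C => Disjoint M C)
  have huniq : ∀ {x : V} {C D : Finset V}, C ∈ P.missing L → D ∈ P.missing L → x ∈ C → x ∈ D →
      C = D := fun {x C D} hC hD hx hx' =>
    eq_of_missing hL (by rw [hL5]; exact hdeg x) hC hD hx hx'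
  have hnL : ∀ {x : V} {C : Finset V}, C ∈ P.missing L → x ∈ C → x ∉ L :=
    fun hC hx h => Finset.disjoint_left.1 (mem_missing.1 hC).2 h hx
  have heC : ∀ C ∈ P.missing L, e ∉ C := fun C hC heC =>
    not_disjoint_of_card hL heL (by rw [he, hL5]) (mem_missing.1 hC).1 heC (mem_missing.1 hC).2
  -- the lines that miss `L` are disjoint pairs which cover all points off `L` but `e`
  have hU : (P.missing L).biUnion id ⊆ (univ \ L).erase e := by
    intro x hx
    obtain ⟨C, hC, hxC⟩ := mem_biUnion.1 hx
    rw [mem_erase, mem_sdiff]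
    exact ⟨by rintro rfl; exact heC C hC hxC, mem_univ x, hnL hC hxC⟩
  have hUc : #((univ \ L).erase e) ≤ 10 := by
    rw [card_erase_of_mem (by simp [heL]), card_sdiff_of_subset (subset_univ L), card_univ, hL5]
    omega
  have hBc : #((P.missing L).biUnion id) = ∑ C ∈ P.missing L, #C := by
    rw [card_biUnion]
    · rfl
    · intro C hC D hD hne
      change Disjoint _ _
      rw [Finset.disjoint_left]
      intro x hx hx'
      exact hne (huniq hC hD hx hx')
  have htwo : ∀ C ∈ P.missing L, 2 ≤ #C := fun C hC => P.two_le_card C (mem_missing.1 hC).1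
  have hlow : #(P.missing L) * 2 ≤ ∑ C ∈ P.missing L, #C := by
    rw [← smul_eq_mul]
    exact card_nsmul_le_sum _ _ _ htwo
  have hUeq : (P.missing L).biUnion id = (univ \ L).erase e :=
    eq_of_subset_of_card_le hU (by omega)
  have hcover : ∀ z, z ∉ L → z ≠ e → ∃ C ∈ P.missing L, z ∈ C := by
    intro z hz hze
    have : z ∈ (univ \ L).erase e := by simp [hz, hze]
    rw [← hUeq] at this
    simpa using this
  have hcard : ∀ C ∈ P.missing L, #C = 2 := by
    have h10 : ∑ C ∈ P.missing L, #C ≤ ∑ C ∈ P.missing L, 2 := by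
      rw [← hBc, hUeq, sum_const, smul_eq_mul]
      omega
    intro C hC
    exact ((sum_eq_sum_iff_of_le htwo).1 (le_antisymm (sum_le_sum htwo) h10) C hC).symm
  obtain ⟨C₅, hC₅⟩ : ({C ∈ P.missing L | Disjoint M C}).Nonempty := card_pos.1 (by omega)
  rw [mem_filter] at hC₅
  obtain ⟨hC₅, hM₅⟩ := hC₅
  obtain ⟨a, b, hab, hCab⟩ := card_eq_two.1 (hcard C₅ hC₅)
  have ha : a ∈ C₅ := by simp [hCab]
  have hb : b ∈ C₅ := by simp [hCab]
  obtain ⟨K⟩ := exists_coding hdeg hL hM hL5 hM5 hLM hmeet hC₅ hM₅ ha hb hab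
  have hagree : ∀ {C D : Finset V} {y z : V}, C ∈ P.missing L → D ∈ P.missing L → C ≠ D → y ∈ C →
      z ∈ D → Word.agree (K.W y) (K.W z) = 1 := fun hC hD hne hy hz =>
    (K.agree_of_mem hL hL5 hdeg hC hy (hnL hD hz) fun h => hne (huniq hC hD h hz)).1
  have hagree_zero : ∀ {C : Finset V} {y z : V}, C ∈ P.missing L → y ∈ C → z ∈ C → y ≠ z →
      Word.agree (K.W y) (K.W z) = 0 := fun hC hy hz hyz => K.agree_of_mem_of_mem hC hy hz hyz
  have hagree_single : ∀ {C : Finset V} {y : V}, C ∈ P.missing L → y ∈ C →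
      Word.agree (K.W y) (K.W e) = 1 ∧ Word.agree (K.W e) (K.W y) = 1 := fun hC hy =>
    K.agree_of_mem hL hL5 hdeg hC hy heL (heC _ hC)
  have hpart : ∀ i, ∃ (C : Finset V) (y : V), i ≠ 0 →
      C ∈ P.missing L ∧ K.xs i ∈ C ∧ y ∈ C ∧ y ≠ K.xs i := by
    intro i
    by_cases hi : i = 0
    · exact ⟨∅, a, fun h => absurd hi h⟩
    · obtain ⟨C, hC, hx⟩ := hcover (K.xs i) (K.xs_notMem i hi)
        (by intro h; exact heM (h ▸ K.xs_mem i))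
      obtain ⟨y, hy, hyx⟩ := exists_mem_ne (P.two_le_card C (mem_missing.1 hC).1) (K.xs i)
      exact ⟨C, y, fun _ => ⟨hC, hx, hy, hyx⟩⟩
  choose C y hCy using hpart
  have hCm : ∀ i, i ≠ 0 → C i ∈ P.missing L := fun i hi => (hCy i hi).1
  have hCx : ∀ i, i ≠ 0 → K.xs i ∈ C i := fun i hi => (hCy i hi).2.1
  have hyC : ∀ i, i ≠ 0 → y i ∈ C i := fun i hi => (hCy i hi).2.2.1
  have hyx : ∀ i, i ≠ 0 → y i ≠ K.xs i := fun i hi => (hCy i hi).2.2.2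
  have hCne : ∀ i j, i ≠ 0 → j ≠ 0 → i ≠ j → C i ≠ C j := by
    intro i j hi hj hij h
    have : C i = M := P.line_unique _ (mem_missing.1 (hCm i hi)).1 _ hM _ _ (K.xs_ne i j hij)
      (hCx i hi) (h ▸ hCx j hj) (K.xs_mem i) (K.xs_mem j)
    exact hmeet (this ▸ (mem_missing.1 (hCm i hi)).2)
  have hC5 : ∀ i, i ≠ 0 → C₅ ≠ C i := fun i hi h =>
    Finset.disjoint_left.1 hM₅ (K.xs_mem i) (h ▸ hCx i hi)
  have h5b : Word.agree Word.base (K.W b) = 0 := K.W_a ▸ hagree_zero hC₅ ha hb hab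
  have h5e : Word.agree Word.base (K.W e) = 1 := K.W_a ▸ (hagree_single hC₅ ha).1
  have hPb : K.W b ∈ Word.candUnpaired := K.mem_candUnpaired (hnL hC₅ hb) fun i hi =>
    hagree (hCm i hi) hC₅ (hC5 i hi).symm (hCx i hi) hb
  have hPe : K.W e ∈ Word.candUnpaired := K.mem_candUnpaired heL fun i hi =>
    (hagree_single (hCm i hi) (hCx i hi)).1
  have hleaf := (Word.search_spec hPb h5b K.W_b hPe h5e (hagree_single hC₅ hb).1).1
  have hQy : ∀ i : Fin 5, i ≠ 0 → K.W (y i) ∈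
      Word.select (K.W e) 1 (Word.select (K.W b) 1 (Word.candPartner i)) := by
    intro i hi
    simp only [Word.mem_select]
    refine ⟨⟨Word.mem_candPartner (K.mem_all _ (hnL (hCm i hi) (hyC i hi))) ?_ ?_, ?_⟩, ?_⟩
    · intro j hj
      obtain ⟨k, hk, hkj, hkW⟩ := K.exists_index hj
      rw [← hkW]
      split_ifs with hij
      · have : k = i := Fin.ext (hkj.trans hij.symm)
        subst this
        exact hagree_zero (hCm k hk) (hCx k hk) (hyC k hk) (hyx k hk).symm
      · have hne : k ≠ i := by rintro rfl; exact hij hkj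
        exact hagree (hCm k hk) (hCm i hi) (hCne k i hk hi hne) (hCx k hk) (hyC i hi)
    · exact K.W_a ▸ hagree hC₅ (hCm i hi) (hC5 i hi) ha (hyC i hi)
    · exact hagree hC₅ (hCm i hi) (hC5 i hi) hb (hyC i hi)
    · exact (hagree_single (hCm i hi) (hyC i hi)).2
  have hyy : ∀ i j, i ≠ 0 → j ≠ 0 → i ≠ j → Word.agree (K.W (y i)) (K.W (y j)) = 1 :=
    fun i j hi hj hij => hagree (hCm i hi) (hCm j hj) (hCne i j hi hj hij) (hyC i hi) (hyC j hj)
  have h1 : (1 : Fin 5) ≠ 0 := by decide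
  have h2 : (2 : Fin 5) ≠ 0 := by decide
  have h3 : (3 : Fin 5) ≠ 0 := by decide
  have h4 : (4 : Fin 5) ≠ 0 := by decide
  have hfull := Word.singleCheck_spec hleaf (hQy 1 h1) (hQy 2 h2) (hQy 3 h3)
    (hQy 4 h4) (hyy 1 2 h1 h2 (by decide)) (hyy 1 3 h1 h3 (by decide))
    (hyy 1 4 h1 h4 (by decide)) (hyy 2 3 h2 h3 (by decide)) (hyy 2 4 h2 h4 (by decide))
    (hyy 3 4 h3 h4 (by decide))
  have hmiss : P.missing L = {C₅, C 1, C 2, C 3, C 4} := by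
    symm
    refine eq_of_subset_of_card_le ?_ ?_
    · intro D hD
      simp only [mem_insert, mem_singleton] at hD
      rcases hD with rfl | rfl | rfl | rfl | rfl
      exacts [hC₅, hCm 1 h1, hCm 2 h2, hCm 3 h3, hCm 4 h4]
    · rw [h5, card_insert_of_notMem, card_insert_of_notMem, card_insert_of_notMem, card_pair]
      · exact hCne 3 4 h3 h4 (by decide)
      · simp [hCne 2 3 h2 h3 (by decide), hCne 2 4 h2 h4 (by decide)]
      · simp [hCne 1 2 h1 h2 (by decide), hCne 1 3 h1 h3 (by decide), hCne 1 4 h1 h4 (by decide)]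
      · simp [hC5 1 h1, hC5 2 h2, hC5 3 h3, hC5 4 h4]
  have hCi : ∀ i, i ≠ 0 → C i = {K.xs i, y i} := by
    intro i hi
    symm
    refine eq_of_subset_of_card_le ?_ ?_
    · intro z hz
      simp only [mem_insert, mem_singleton] at hz
      rcases hz with rfl | rfl
      exacts [hCx i hi, hyC i hi]
    · rw [hcard _ (hCm i hi), card_pair (hyx i hi).symm]
  have hT : ∀ z ∉ L, z ∈ [y 1, y 2, y 3, y 4, K.xs 1, K.xs 2, K.xs 3, K.xs 4, a, b, e] := by
    intro z hzL
    by_cases hze : z = e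
    · simp [hze]
    obtain ⟨D, hD, hzD⟩ := hcover z hzL hze
    rw [hmiss] at hD
    simp only [mem_insert, mem_singleton] at hD
    rcases hD with rfl | rfl | rfl | rfl | rfl
    · rw [hCab] at hzD
      simp only [mem_insert, mem_singleton] at hzD
      rcases hzD with rfl | rfl <;> simp
    all_goals
      rw [hCi _ (by assumption)] at hzD
      simp only [mem_insert, mem_singleton] at hzD
      rcases hzD with rfl | rfl <;> simp
  have hfin := K.le_numFull _ hT
  simp only [List.map_cons, List.map_nil, K.W_a, K.W_xs 1 h1, K.W_xs 2 h2, K.W_xs 3 h3,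
    K.W_xs 4 h4] at hfin
  exact absurd (hF.trans hfin) (by
    have h : Word.numFull _ ≤ 4 := hfull
    exact Nat.not_le.2 (Nat.lt_succ_of_le h))

/-- The case `q = 5`. Counting the lines through the points of a five-point line `L` gives
`5 + d ≤ s + t`, where `e` is on `d` lines, `s` points of `L` are on six lines, and `t` lines
miss `L`. -/
theorem card_avoid_le_of_five (hdeg : ∀ x, #(P.pencil x) ≤ 6) (e : V) : #(P.avoid e) ≤ 25 := by
  by_cases hlong : ∃ L ∈ P.lines, 5 + 1 ≤ #L
  · obtain ⟨L, hL, hL6⟩ := hlong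
    exact card_avoid_le_of_long_line (q := 5) hdeg e hL hL6
  push Not at hlong
  by_contra! hB
  obtain ⟨L, hL, M, hM, hL5, hM5, hLM, hmeet⟩ :=
    exists_meeting_of_avoid hdeg (fun ℓ hℓ => Nat.le_of_lt_succ (hlong ℓ hℓ)) hB
  -- the number of lines that miss a five-point line
  have hcount : ∀ L ∈ P.lines, #L = 5 →
      5 + #(P.pencil e) ≤ #{x ∈ L | #(P.pencil x) = 6} + #(P.missing L) := by
    intro L hL hL5
    have h1 := card_lines_eq_sum hL
    have h2 := P.card_lines_eq e
    have h3 : ∑ x ∈ L, (#(P.pencil x) - 1) ≤ ∑ x ∈ L, (4 + if #(P.pencil x) = 6 then 1 else 0) := by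
      refine sum_le_sum fun x _ => ?_
      have := hdeg x
      split_ifs <;> omega
    rw [sum_add_distrib, sum_const, smul_eq_mul, hL5, ← card_filter] at h3
    omega
  have hcount' : ∀ L ∈ P.lines, #L = 5 → e ∈ L →
      10 ≤ #{x ∈ L.erase e | #(P.pencil x) = 6} + #(P.missing L) := by
    intro L hL hL5 heL
    have h1 := card_lines_eq_sum hL
    have h2 := P.card_lines_eq e
    have h3 : ∑ x ∈ L.erase e, (#(P.pencil x) - 1) ≤
        ∑ x ∈ L.erase e, (4 + if #(P.pencil x) = 6 then 1 else 0) := by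
      refine sum_le_sum fun x _ => ?_
      have := hdeg x
      split_ifs <;> omega
    rw [sum_add_distrib, sum_const, smul_eq_mul, card_erase_of_mem heL, hL5, ← card_filter] at h3
    have h4 := add_sum_erase L (fun x => #(P.pencil x) - 1) heL
    have h5 := card_pencil_pos hL heL
    omega
  -- two meeting five-point lines, one of them through `e`
  have hthrough : ∀ L ∈ P.lines, ∀ M ∈ P.lines, #L = 5 → #M = 5 → L ≠ M → ¬ Disjoint L M →
      e ∈ L → False := by
    intro L hL M hM hL5 hM5 hLM hmeet heL
    have h1 := hcount' L hL hL5 heL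
    have h2 : #{x ∈ L.erase e | #(P.pencil x) = 6} ≤ 4 :=
      (card_filter_le _ _).trans (by rw [card_erase_of_mem heL, hL5])
    have h3 : #{x ∈ L.erase e | #(P.pencil x) = 6} ≤ #{x ∈ L | #(P.pencil x) = 6} :=
      card_le_card (filter_subset_filter _ (erase_subset e L))
    exact false_of_six_missing hdeg hL hM hL5 hM5 hLM hmeet (by omega) (by omega)
  by_cases heL : e ∈ L
  · exact hthrough L hL M hM hL5 hM5 hLM hmeet heL
  by_cases heM : e ∈ M
  · exact hthrough M hM L hL hM5 hL5 hLM.symm (fun h => hmeet h.symm) heM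
  have h1 := hcount L hL hL5
  have h2 : #{x ∈ L | #(P.pencil x) = 6} ≤ 5 := (card_filter_le _ _).trans hL5.le
  have h3 := card_le_card_pencil hL heL
  have h4 := hdeg e
  by_cases h6 : 6 ≤ #(P.missing L)
  · exact false_of_six_missing hdeg hL hM hL5 hM5 hLM hmeet h6 (by omega)
  have he5 : #(P.pencil e) = 5 := by omega
  -- exactly five lines miss `L`; as `e` is on five lines, every line through `e` meets `L`
  by_cases hK : ∃ K ∈ P.pencil e, #K = 5
  · obtain ⟨K, hK, hK5⟩ := hK
    rw [mem_pencil] at hK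
    exact hthrough K hK.1 L hL hK5 hL5 (by rintro rfl; exact heL hK.2)
      (fun h => not_disjoint_of_card hL heL (by omega) hK.1 hK.2 h.symm) hK.2
  push Not at hK
  refine false_of_five_missing hdeg hL hM hL5 hM5 hLM hmeet (by omega) (by omega) heL heM he5 ?_
  -- the five lines through `e` have at most four points each, so there are at most 16 points
  have h7 := P.sum_pencil e
  have h8 : ∑ ℓ ∈ P.pencil e, ((#ℓ : ℤ) - 1) ≤ ∑ ℓ ∈ P.pencil e, 3 := by
    refine sum_le_sum fun ℓ hℓ => ?_
    have h9 := hlong ℓ (mem_pencil.1 hℓ).1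
    have h10 := hK ℓ hℓ
    have : (#ℓ : ℤ) ≤ 4 := by
      have : #ℓ ≤ 4 := by omega
      exact_mod_cast this
    linarith
  rw [h7, sum_const, he5, nsmul_eq_mul] at h8
  push_cast at h8
  have : (Fintype.card V : ℤ) ≤ 16 := by linarith
  exact_mod_cast this

/-- In a linear space in which all points are on at most `q + 1` lines, where `2 ≤ q ≤ 5`, at most
`q ^ 2` lines avoid a given point. -/
theorem card_avoid_le {q : ℕ} (hq : q ∈ ({2, 3, 4, 5} : Set ℕ))
    (hdeg : ∀ x, #(P.pencil x) ≤ q + 1) (e : V) : #(P.avoid e) ≤ q ^ 2 := by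
  simp only [Set.mem_insert_iff, Set.mem_singleton_iff] at hq
  rcases hq with rfl | rfl | rfl | rfl
  · exact card_avoid_le_of_le_four le_rfl (by norm_num) hdeg e
  · exact card_avoid_le_of_le_four (by norm_num) (by norm_num) hdeg e
  · exact card_avoid_le_of_le_four (by norm_num) le_rfl hdeg e
  · exact card_avoid_le_of_five hdeg e

end LinearSpace
end LinesMatroid

namespace LinesMatroid

open Set
open scoped Matroid

variable {α : Type*} {M : Matroid α} {F G H K : Set α} {x y : α} {k q : ℕ}

/-! ### Intervals of length two in the lattice of flats -/

lemma eRk_closure_insert (hF : M.IsFlat F) (hFk : M.eRk F = k) (hx : x ∈ M.E) (hxF : x ∉ F) :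
    M.eRk (M.closure (insert x F)) = (k + 1 : ℕ) := by
  rw [M.eRk_closure_eq, Matroid.eRk_insert_eq_add_one ⟨hx, by rwa [hF.closure]⟩, hFk]
  push_cast; rfl

lemma subset_closure_insert (hF : M.IsFlat F) (hx : x ∈ M.E) :
    F ⊆ M.closure (insert x F) ∧ x ∈ M.closure (insert x F) := by
  have h := M.subset_closure (insert x F) (insert_subset hx hF.subset_ground)
  exact ⟨(subset_insert x F).trans h, h (mem_insert x F)⟩

lemma closure_insert_subset (hG : M.IsFlat G) (hFG : F ⊆ G) (hx : x ∈ G) :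
    M.closure (insert x F) ⊆ G := by
  conv_rhs => rw [← hG.closure]
  exact M.closure_subset_closure (insert_subset hx hFG)

lemma eq_of_subset_of_eRk [M.Finite] (hF : M.IsFlat F) (hG : M.IsFlat G) (hFG : F ⊆ G)
    (hF' : M.eRk F = k) (hG' : M.eRk G = k) : F = G := by
  have hfin : M.IsRkFinite F := by
    rw [← Matroid.eRk_lt_top_iff, hF']; exact ENat.natCast_lt_top k
  have := hfin.closure_eq_closure_of_subset_of_eRk_ge_eRk hFG (by rw [hF', hG'])
  rwa [hF.closure, hG.closure] at this

lemma eq_closure_insert [M.Finite] (hF : M.IsFlat F) (hFk : M.eRk F = k) (hH : M.IsFlat H)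
    (hHk : M.eRk H = (k + 1 : ℕ)) (hFH : F ⊆ H) (hxH : x ∈ H) (hxF : x ∉ F) :
    M.closure (insert x F) = H :=
  eq_of_subset_of_eRk (M.isFlat_closure _) hH (closure_insert_subset hH hFH hxH)
    (eRk_closure_insert hF hFk (hH.subset_ground hxH) hxF) hHk

lemma exists_mem_notMem {l : ℕ} (hFk : M.eRk F = k) (hGl : M.eRk G = l) (hkl : k < l) :
    ∃ x ∈ G, x ∉ F := by
  by_contra! h
  have := M.eRk_mono h
  rw [hFk, hGl] at this
  exact absurd (by exact_mod_cast this) (Nat.not_le.2 hkl)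

/-- The flats of rank `k` that lie between `F` and `G`. -/
def flatsBetween (M : Matroid α) (F G : Set α) (k : ℕ) : Set (Set α) :=
  {H | M.IsFlat H ∧ F ⊆ H ∧ H ⊆ G ∧ M.eRk H = k}

lemma finite_flatsBetween [M.Finite] : (flatsBetween M F G k).Finite :=
  M.ground_finite.finite_subsets.subset fun _ hH => hH.1.subset_ground

/-- Elements `m i` of `G \ F` that span different flats with `F` form a uniform matroid of rank two
after contraction of `F`, where `G` has rank two more than `F`. -/
lemma contract_indep_iff_of_flats {ι : Type*} {m : ι → α} {B : Set α} [M.Finite]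
    (hF : M.IsFlat F) (hFk : M.eRk F = k) (hGk : M.eRk G = (k + 2 : ℕ)) (hFG : F ⊆ G)
    (hB : M.IsBasis B F) (hmG : ∀ i, m i ∈ G) (hGE : G ⊆ M.E) (hmF : ∀ i, m i ∉ F)
    (hinj : ∀ i j, i ≠ j → m j ∉ M.closure (insert (m i) F)) (I : Set ι) :
    (M ／ F).Indep (m '' I) ↔ I.encard ≤ 2 := by
  have hm : Function.Injective m := by
    intro i j hij
    by_contra hne
    exact hinj i j hne (hij ▸ (subset_closure_insert hF (hGE (hmG i))).2)
  have hdisj : Disjoint F (m '' I) := by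
    rw [Set.disjoint_right]
    rintro _ ⟨i, -, rfl⟩
    exact hmF i
  rw [hB.contract_indep_iff_of_disjoint hdisj, ← hm.injOn.encard_image (s := I)]
  have hBk : B.encard = k := by rw [← hFk, hB.encard_eq_eRk]
  have hBfin : B.Finite := by
    rw [← encard_lt_top_iff, hBk]; exact ENat.natCast_lt_top k
  constructor
  · intro h
    have h1 := h.encard_le_eRk_of_subset (X := G)
      (union_subset (by rintro _ ⟨i, -, rfl⟩; exact hmG i) (hB.subset.trans hFG))
    rw [encard_union_eq ((hdisj.mono_left hB.subset).symm), hBk, hGk, add_comm] at h1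
    push_cast at h1
    exact (ENat.add_le_add_iff_left (ENat.natCast_ne_top k)).1 h1
  · intro h
    have hfin : (m '' I).Finite := by
      rw [← encard_lt_top_iff]; exact lt_of_le_of_lt h (by decide)
    have hins : ∀ i, M.Indep (insert (m i) B) := by
      intro i
      rw [hB.indep.insert_indep_iff, hB.closure_eq_closure, hF.closure]
      exact Or.inl ⟨hGE (hmG i), hmF i⟩
    rcases (m '' I).eq_empty_or_nonempty with h0 | ⟨_, ⟨i, hi, rfl⟩⟩
    · rw [h0, empty_union]; exact hB.indep
    by_cases hall : ∀ j ∈ I, j = i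
    · refine (hins i).subset ?_
      rintro z (⟨j, hj, rfl⟩ | hz)
      · rw [hall j hj]; exact mem_insert _ _
      · exact mem_insert_of_mem _ hz
    · push Not at hall
      obtain ⟨j, hj, hji⟩ := hall
      have h2 : m '' I = {m i, m j} := by
        symm
        refine (toFinite _).eq_of_subset_of_encard_le ?_ ?_
        · rintro z (rfl | rfl)
          exacts [⟨i, hi, rfl⟩, ⟨j, hj, rfl⟩]
        · rw [encard_pair (hm.ne hji.symm)]; exact h
      have h3 : M.Indep (insert (m j) (insert (m i) B)) := by
        rw [(hins i).insert_indep_iff]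
        refine Or.inl ⟨hGE (hmG j), fun hc => hinj i j hji.symm ?_⟩
        refine M.closure_subset_closure (insert_subset_insert hB.subset) hc
      refine h3.subset ?_
      rw [h2]
      rintro z ((rfl | rfl) | hz)
      · exact mem_insert_of_mem _ (mem_insert _ _)
      · exact mem_insert _ _
      · exact mem_insert_of_mem _ (mem_insert_of_mem _ hz)

/-- An interval of length two in the lattice of flats has at most `q + 1` atoms. -/
theorem ncard_flatsBetween_le [M.Finite] (hM : NoLineMinor q M) (hF : M.IsFlat F)
    (hG : M.IsFlat G) (hFG : F ⊆ G) (hFk : M.eRk F = k) (hGk : M.eRk G = (k + 2 : ℕ)) :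
    (flatsBetween M F G (k + 1)).ncard ≤ q + 1 := by
  by_contra! hlt
  have hfin : (flatsBetween M F G (k + 1)).Finite := finite_flatsBetween
  obtain ⟨T, hT, hTc⟩ := exists_subset_card_eq (s := flatsBetween M F G (k + 1)) (n := q + 2) hlt
  have hTfin : T.Finite := hfin.subset hT
  have : Finite T := hTfin
  obtain ⟨g⟩ : Nonempty (Fin (q + 2) ≃ T) := by
    rw [← hTc]
    exact ⟨(Finite.equivFinOfCardEq rfl).symm⟩
  have hHs : ∀ i, (g i : Set α) ∈ flatsBetween M F G (k + 1) := fun i => hT (g i).2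
  have hx : ∀ i, ∃ x ∈ (g i : Set α), x ∉ F := fun i =>
    exists_mem_notMem hFk (hHs i).2.2.2 (Nat.lt_succ_self k)
  choose m hmH hmF using hx
  have hcl : ∀ i, M.closure (insert (m i) F) = g i := fun i =>
    eq_closure_insert hF hFk (hHs i).1 (hHs i).2.2.2 (hHs i).2.1 (hmH i) (hmF i)
  have hinj : ∀ i j, i ≠ j → m j ∉ M.closure (insert (m i) F) := by
    intro i j hij hmem
    rw [hcl i] at hmem
    have h1 := eq_closure_insert hF hFk (hHs i).1 (hHs i).2.2.2 (hHs i).2.1 hmem (hmF j)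
    rw [hcl j] at h1
    exact hij (g.injective (Subtype.ext h1)).symm
  have hGE := hG.subset_ground
  have hmG : ∀ i, m i ∈ G := fun i => (hHs i).2.2.1 (hmH i)
  have hm : Function.Injective m := by
    intro i j hij
    by_contra hne
    exact hinj i j hne (hij ▸ (subset_closure_insert hF (hGE (hmG i))).2)
  obtain ⟨B, hB⟩ := M.exists_isBasis F hF.subset_ground
  have hind := contract_indep_iff_of_flats hF hFk hGk hFG hB hmG hGE hmF hinj
  have hground : (M ／ F ＼ (M.E \ range m)).E = range m := by
    ext z
    simp only [Matroid.delete_ground, Matroid.contract_ground, mem_sdiff]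
    constructor
    · rintro ⟨⟨h1, -⟩, h2⟩
      by_contra h3
      exact h2 ⟨h1, h3⟩
    · rintro ⟨i, rfl⟩
      exact ⟨⟨hGE (hmG i), hmF i⟩, fun h => h.2 ⟨i, rfl⟩⟩
  refine hM _ (M.contract_delete_isMinor F (M.E \ range m)) ?_
  have hmem : ∀ i, m i ∈ (M ／ F ＼ (M.E \ range m)).E := fun i => by
    rw [hground]; exact mem_range_self i
  have hbij : Function.Bijective fun i : (uniform 2 (q + 2)).E =>
      (⟨m i, hmem i⟩ : (M ／ F ＼ (M.E \ range m)).E) := by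
    constructor
    · intro i j hij
      exact Subtype.ext (hm (congrArg Subtype.val hij))
    · rintro ⟨z, hz⟩
      have hz' := hz
      rw [hground] at hz'
      obtain ⟨i, rfl⟩ := hz'
      exact ⟨⟨i, mem_univ i⟩, rfl⟩
  refine ⟨(Equiv.ofBijective _ hbij).symm, fun I => ?_⟩
  set J : Set (Fin (q + 2)) := Subtype.val '' ((Equiv.ofBijective _ hbij).symm '' I) with hJ
  have hIJ : Subtype.val '' I = m '' J := by
    rw [hJ, image_image, image_image]
    refine image_congr fun z _ => ?_
    exact congrArg Subtype.val ((Equiv.ofBijective _ hbij).apply_symm_apply z).symm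
  have hdis : Disjoint (m '' J) (M.E \ range m) :=
    Set.disjoint_left.2 fun z hz hz' => hz'.2 (image_subset_range m J hz)
  rw [hIJ, Matroid.delete_indep_iff, and_iff_left hdis, hind, uniform_indep_iff,
    ← J.toFinite.cast_ncard_eq]
  exact_mod_cast Iff.rfl

/-! ### Intervals of length three -/

lemma exists_two_of_mem (hF : M.IsFlat F) (hFk : M.eRk F = k)
    (hK : K ∈ flatsBetween M F G (k + 2)) :
    ∃ H₁ ∈ flatsBetween M F G (k + 1), ∃ H₂ ∈ flatsBetween M F G (k + 1),
      H₁ ≠ H₂ ∧ H₁ ⊆ K ∧ H₂ ⊆ K := by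
  obtain ⟨hKf, hFK, hKG, hKk⟩ := hK
  have hE := hKf.subset_ground
  obtain ⟨x, hxK, hxF⟩ := exists_mem_notMem hFk hKk (by omega)
  have h1 := eRk_closure_insert hF hFk (hE hxK) hxF
  have h1K := closure_insert_subset hKf hFK hxK
  obtain ⟨y, hyK, hyH⟩ := exists_mem_notMem h1 hKk (by omega)
  have hyF : y ∉ F := fun h => hyH ((subset_closure_insert hF (hE hxK)).1 h)
  have h2K := closure_insert_subset hKf hFK hyK
  refine ⟨_, ⟨M.isFlat_closure _, (subset_closure_insert hF (hE hxK)).1, h1K.trans hKG, h1⟩,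
    _, ⟨M.isFlat_closure _, (subset_closure_insert hF (hE hyK)).1, h2K.trans hKG,
      eRk_closure_insert hF hFk (hE hyK) hyF⟩, ?_, h1K, h2K⟩
  intro h
  exact hyH (h ▸ (subset_closure_insert hF (hE hyK)).2)

section Interval

variable {H₁ H₂ K' : Set α} [M.Finite]

lemma exists_mem_sdiff_of_ne (h₁ : H₁ ∈ flatsBetween M F G k) (h₂ : H₂ ∈ flatsBetween M F G k)
    (hne : H₁ ≠ H₂) : ∃ y ∈ H₂, y ∉ H₁ := by
  by_contra! h
  exact hne (eq_of_subset_of_eRk h₂.1 h₁.1 h h₂.2.2.2 h₁.2.2.2).symm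

lemma exists_flat_of_ne (hF : M.IsFlat F) (hG : M.IsFlat G) (hFk : M.eRk F = k)
    (h₁ : H₁ ∈ flatsBetween M F G (k + 1)) (h₂ : H₂ ∈ flatsBetween M F G (k + 1))
    (hne : H₁ ≠ H₂) : ∃ K ∈ flatsBetween M F G (k + 2), H₁ ⊆ K ∧ H₂ ⊆ K := by
  obtain ⟨y, hy2, hy1⟩ := exists_mem_sdiff_of_ne h₁ h₂ hne
  have hyE := h₂.1.subset_ground hy2
  obtain ⟨hs, hys⟩ := subset_closure_insert h₁.1 hyE
  refine ⟨M.closure (insert y H₁), ⟨M.isFlat_closure _, h₁.2.1.trans hs,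
    closure_insert_subset hG h₁.2.2.1 (h₂.2.2.1 hy2),
    eRk_closure_insert h₁.1 h₁.2.2.2 hyE hy1⟩, hs, ?_⟩
  rw [← eq_closure_insert hF hFk h₂.1 h₂.2.2.2 h₂.2.1 hy2 fun h => hy1 (h₁.2.1 h)]
  exact closure_insert_subset (M.isFlat_closure _) (h₁.2.1.trans hs) hys

lemma flat_unique (h₁ : H₁ ∈ flatsBetween M F G (k + 1)) (h₂ : H₂ ∈ flatsBetween M F G (k + 1))
    (hne : H₁ ≠ H₂) (hK : K ∈ flatsBetween M F G (k + 2)) (hK' : K' ∈ flatsBetween M F G (k + 2))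
    (h1K : H₁ ⊆ K) (h2K : H₂ ⊆ K) (h1K' : H₁ ⊆ K') (h2K' : H₂ ⊆ K') : K = K' := by
  obtain ⟨y, hy2, hy1⟩ := exists_mem_sdiff_of_ne h₁ h₂ hne
  rw [← eq_closure_insert h₁.1 h₁.2.2.2 hK.1 hK.2.2.2 h1K (h2K hy2) hy1,
    ← eq_closure_insert h₁.1 h₁.2.2.2 hK'.1 hK'.2.2.2 h1K' (h2K' hy2) hy1]

noncomputable instance fintypeFlatsBetween : Fintype (flatsBetween M F G k) :=
  finite_flatsBetween.fintype

open Classical in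
/-- The flats of rank `k` between `F` and `G` that are contained in `K`, as a finset. -/
noncomputable def flatsBelow (M : Matroid α) [M.Finite] (F G : Set α) (k : ℕ) (K : Set α) :
    Finset (flatsBetween M F G k) := Finset.univ.filter fun H => (H : Set α) ⊆ K

open Classical in
/-- The flats between `F` and `G` of rank one and two more than `F`, as the points and the lines of
a linear space. A flat of rank two more than `F` is encoded as the set of points below it. -/
noncomputable def intervalSpace (hF : M.IsFlat F) (hG : M.IsFlat G) (hFk : M.eRk F = k) :
    LinearSpace (flatsBetween M F G (k + 1)) where
  lines := (finite_flatsBetween (M := M) (F := F) (G := G) (k := k + 2)).toFinset.image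
    (flatsBelow M F G (k + 1))
  two_le_card := by
    intro ℓ hℓ
    obtain ⟨K, hK, rfl⟩ := Finset.mem_image.1 hℓ
    rw [Set.Finite.mem_toFinset] at hK
    obtain ⟨H₁, h₁, H₂, h₂, hne, h1, h2⟩ := exists_two_of_mem hF hFk hK
    refine Finset.one_lt_card.2 ⟨⟨H₁, h₁⟩, by simpa [flatsBelow] using h1, ⟨H₂, h₂⟩,
      by simpa [flatsBelow] using h2, fun h => hne (congrArg Subtype.val h)⟩
  exists_line := by
    rintro ⟨H₁, h₁⟩ ⟨H₂, h₂⟩ hne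
    obtain ⟨K, hK, h1, h2⟩ := exists_flat_of_ne hF hG hFk h₁ h₂ fun h => hne (Subtype.ext h)
    exact ⟨_, Finset.mem_image.2 ⟨K, (Set.Finite.mem_toFinset _).2 hK, rfl⟩,
      by simpa [flatsBelow] using h1, by simpa [flatsBelow] using h2⟩
  line_unique := by
    rintro ℓ hℓ m hm ⟨H₁, h₁⟩ ⟨H₂, h₂⟩ hne hx hy hx' hy'
    obtain ⟨K, hK, rfl⟩ := Finset.mem_image.1 hℓ
    obtain ⟨K', hK', rfl⟩ := Finset.mem_image.1 hm
    rw [Set.Finite.mem_toFinset] at hK hK'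
    simp only [flatsBelow, Finset.mem_filter, Finset.mem_univ, true_and] at hx hy hx' hy'
    simp only [flat_unique h₁ h₂ (fun h => hne (Subtype.ext h)) hK hK' hx hy hx' hy']

lemma flatsBelow_injOn (hF : M.IsFlat F) (hFk : M.eRk F = k) :
    InjOn (flatsBelow M F G (k + 1)) (flatsBetween M F G (k + 2)) := by
  intro K hK K' hK' h
  obtain ⟨H₁, h₁, H₂, h₂, hne, h1, h2⟩ := exists_two_of_mem hF hFk hK
  have h1' : (⟨H₁, h₁⟩ : flatsBetween M F G (k + 1)) ∈ flatsBelow M F G (k + 1) K := by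
    simpa [flatsBelow] using h1
  have h2' : (⟨H₂, h₂⟩ : flatsBetween M F G (k + 1)) ∈ flatsBelow M F G (k + 1) K := by
    simpa [flatsBelow] using h2
  rw [h] at h1' h2'
  simp only [flatsBelow, Finset.mem_filter, Finset.mem_univ, true_and] at h1' h2'
  exact flat_unique h₁ h₂ hne hK hK' h1 h2 h1' h2'

/-- In an interval of length three, at most `q ^ 2` lines avoid a given point. -/
theorem ncard_not_subset_le (hq : q ∈ ({2, 3, 4, 5} : Set ℕ)) (hM : NoLineMinor q M)
    (hF : M.IsFlat F) (hG : M.IsFlat G) (hFk : M.eRk F = k) (hGk : M.eRk G = (k + 3 : ℕ))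
    (hH : H ∈ flatsBetween M F G (k + 1)) :
    {K ∈ flatsBetween M F G (k + 2) | ¬ H ⊆ K}.ncard ≤ q ^ 2 := by
  classical
  have hdeg : ∀ x, ((intervalSpace hF hG hFk).pencil x).card ≤ q + 1 := by
    rintro ⟨H', hH'⟩
    rw [← ncard_coe_finset]
    refine le_trans ?_ (ncard_flatsBetween_le hM hH'.1 hG hH'.2.2.1 hH'.2.2.2 hGk)
    refine le_trans (ncard_le_ncard (t := flatsBelow M F G (k + 1) '' flatsBetween M H' G (k + 2))
      ?_ (finite_flatsBetween.image _)) (ncard_image_le finite_flatsBetween)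
    intro ℓ hℓ
    rw [Finset.mem_coe, LinearSpace.mem_pencil] at hℓ
    obtain ⟨K, hK, rfl⟩ := Finset.mem_image.1 hℓ.1
    rw [Set.Finite.mem_toFinset] at hK
    have hx := hℓ.2
    simp only [flatsBelow, Finset.mem_filter, Finset.mem_univ, true_and] at hx
    exact ⟨K, ⟨hK.1, hx, hK.2.2⟩, rfl⟩
  have key := LinearSpace.card_avoid_le hq hdeg ⟨H, hH⟩
  rw [← ncard_coe_finset] at key
  refine le_trans ?_ key
  refine ncard_le_ncard_of_injOn (flatsBelow M F G (k + 1)) ?_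
    ((flatsBelow_injOn hF hFk).mono fun K hK => hK.1) (Finset.finite_toSet _)
  rintro K ⟨hK, hHK⟩
  rw [Finset.mem_coe, LinearSpace.mem_avoid]
  refine ⟨Finset.mem_image.2 ⟨K, (Set.Finite.mem_toFinset _).2 hK, rfl⟩, ?_⟩
  simpa [flatsBelow] using hHK

end Interval

/-! ### Induction on the corank -/

lemma flatsBetween_eq_empty {m : ℕ} (hr : M.eRank = m) (hmk : m < k) :
    flatsBetween M F G k = ∅ := by
  rw [eq_empty_iff_forall_notMem]
  rintro H ⟨-, -, -, hH⟩
  have h := M.eRk_le_eRank H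
  rw [hH, hr] at h
  exact absurd (by exact_mod_cast h) (Nat.not_le.2 hmk)

lemma exists_cover {m : ℕ} (hF : M.IsFlat F) (hFk : M.eRk F = k) (hr : M.eRank = m)
    (hkm : k < m) : (flatsBetween M F M.E (k + 1)).Nonempty := by
  obtain ⟨x, hxE, hxF⟩ := exists_mem_notMem hFk (by rw [M.eRk_ground, hr]) hkm
  exact ⟨M.closure (insert x F), M.isFlat_closure _, (subset_closure_insert hF hxE).1,
    M.closure_subset_ground _, eRk_closure_insert hF hFk hxE hxF⟩

section Induction

variable [M.Finite]

/-- A flat `H` above `F` and a flat `E₀` covering `F` but not contained in `H` span a flat whose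
rank is one more than that of `H`. -/
lemma exists_flat_above {E₀ : Set α} {j : ℕ} (hF : M.IsFlat F) (hFk : M.eRk F = k)
    (hE₀ : E₀ ∈ flatsBetween M F M.E (k + 1)) (hH : H ∈ flatsBetween M F M.E (k + j))
    (hne : ¬ E₀ ⊆ H) : ∃ G ∈ flatsBetween M E₀ M.E (k + 1 + j), H ⊆ G := by
  obtain ⟨x, hx, hxH⟩ := not_subset.1 hne
  have hxE := hE₀.2.2.1 hx
  obtain ⟨hs, hxs⟩ := subset_closure_insert hH.1 hxE
  refine ⟨M.closure (insert x H), ⟨M.isFlat_closure _, ?_, M.closure_subset_ground _, ?_⟩, hs⟩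
  · rw [← eq_closure_insert hF hFk hE₀.1 hE₀.2.2.2 hE₀.2.1 hx fun h => hxH (hH.2.1 h)]
    exact closure_insert_subset (M.isFlat_closure _) (hH.2.1.trans hs) hxs
  · rw [eRk_closure_insert hH.1 hH.2.2.2 hxE hxH]
    congr 1
    omega

lemma ncard_le_mul_ncard {S T : Set (Set α)} {c : ℕ} (hS : S.Finite) (hT : T.Finite)
    (hST : ∀ K ∈ S, ∃ G ∈ T, K ⊆ G) (hc : ∀ G ∈ T, {K ∈ S | K ⊆ G}.ncard ≤ c) :
    S.ncard ≤ c * T.ncard := by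
  classical
  choose! f hfT hf using hST
  rw [ncard_eq_toFinset_card S hS, ncard_eq_toFinset_card T hT]
  refine Finset.card_le_mul_card_image_of_maps_to (f := f) (by simpa using hfT) c fun G hG => ?_
  refine le_trans ?_ (hc G (by simpa using hG))
  rw [← ncard_coe_finset]
  refine ncard_le_ncard ?_ (hS.subset fun K hK => hK.1)
  intro K hK
  simp only [Finset.coe_filter, Set.Finite.mem_toFinset, mem_ofPred_eq] at hK
  exact ⟨hK.1, hK.2 ▸ hf K hK.1⟩

/-- Kung's bound on the number of flats that cover a flat `F` of corank `m`. All but one of them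
span with a fixed cover `E₀` a flat that covers `E₀`, which contains at most `q` of them. -/
theorem ncard_covers_le (hM : NoLineMinor q M) (m : ℕ) :
    ∀ {F : Set α} {k : ℕ}, M.IsFlat F → M.eRk F = k → M.eRank = (k + m : ℕ) →
      (flatsBetween M F M.E (k + 1)).ncard ≤ ∑ i ∈ Finset.range m, q ^ i := by
  induction m with
  | zero =>
    intro F k hF hFk hr
    simp [flatsBetween_eq_empty hr (Nat.lt_succ_self k)]
  | succ m ih =>
    intro F k hF hFk hr
    obtain ⟨E₀, hE₀⟩ := exists_cover hF hFk hr (by omega)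
    have hih := ih hE₀.1 hE₀.2.2.2 (by rw [hr]; congr 1; omega)
    have hsub : flatsBetween M F M.E (k + 1) ⊆
        insert E₀ {H ∈ flatsBetween M F M.E (k + 1) | ¬ E₀ ⊆ H} := by
      intro H hH
      by_cases h : E₀ ⊆ H
      · exact Or.inl (eq_of_subset_of_eRk hE₀.1 hH.1 h hE₀.2.2.2 hH.2.2.2).symm
      · exact Or.inr ⟨hH, h⟩
    have hfin : {H ∈ flatsBetween M F M.E (k + 1) | ¬ E₀ ⊆ H}.Finite :=
      finite_flatsBetween.subset fun H hH => hH.1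
    have hcount : {H ∈ flatsBetween M F M.E (k + 1) | ¬ E₀ ⊆ H}.ncard ≤
        q * (flatsBetween M E₀ M.E (k + 1 + 1)).ncard := by
      refine ncard_le_mul_ncard hfin finite_flatsBetween
        (fun H hH => exists_flat_above hF hFk hE₀ hH.1 hH.2) fun G hG => ?_
      have h1 := ncard_flatsBetween_le hM hF hG.1 (hE₀.2.1.trans hG.2.1) hFk hG.2.2.2
      have h2 : insert E₀ {H ∈ {H ∈ flatsBetween M F M.E (k + 1) | ¬ E₀ ⊆ H} | H ⊆ G} ⊆
          flatsBetween M F G (k + 1) := by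
        rintro H (rfl | ⟨⟨hH, -⟩, hHG⟩)
        · exact ⟨hE₀.1, hE₀.2.1, hG.2.1, hE₀.2.2.2⟩
        · exact ⟨hH.1, hH.2.1, hHG, hH.2.2.2⟩
      have h3 := ncard_le_ncard h2 finite_flatsBetween
      rw [ncard_insert_of_notMem (fun h => h.1.2 Subset.rfl) (hfin.subset fun H hH => hH.1)] at h3
      omega
    calc (flatsBetween M F M.E (k + 1)).ncard
        ≤ {H ∈ flatsBetween M F M.E (k + 1) | ¬ E₀ ⊆ H}.ncard + 1 :=
          (ncard_le_ncard hsub (hfin.insert E₀)).trans (ncard_insert_le _ _)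
      _ ≤ q * (∑ i ∈ Finset.range m, q ^ i) + 1 := by
          gcongr
          exact hcount.trans (Nat.mul_le_mul_left q hih)
      _ = ∑ i ∈ Finset.range (m + 1), q ^ i := by
          rw [Finset.sum_range_succ', Finset.mul_sum, pow_zero]
          congr 1
          exact Finset.sum_congr rfl fun i _ => (pow_succ' q i).symm

/-- The bound on the number of flats of rank two more than a flat of corank `m`, as a recursion. -/
def lineBound (q : ℕ) : ℕ → ℕ
  | 0 => 0
  | m + 1 => ∑ i ∈ Finset.range m, q ^ i + q ^ 2 * lineBound q m

/-- The bound on the number of flats of rank two more than a flat of corank `m`. -/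
theorem ncard_lines_le (hq : q ∈ ({2, 3, 4, 5} : Set ℕ)) (hM : NoLineMinor q M) (m : ℕ) :
    ∀ {F : Set α} {k : ℕ}, M.IsFlat F → M.eRk F = k → M.eRank = (k + m : ℕ) →
      (flatsBetween M F M.E (k + 2)).ncard ≤ lineBound q m := by
  induction m with
  | zero =>
    intro F k hF hFk hr
    simp [flatsBetween_eq_empty hr (show k + 0 < k + 2 by omega)]
  | succ m ih =>
    intro F k hF hFk hr
    obtain ⟨E₀, hE₀⟩ := exists_cover hF hFk hr (by omega)
    have hr' : M.eRank = (k + 1 + m : ℕ) := by rw [hr]; congr 1; omega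
    have hih := ih hE₀.1 hE₀.2.2.2 hr'
    have hcov := ncard_covers_le hM m hE₀.1 hE₀.2.2.2 hr'
    have hsub : flatsBetween M F M.E (k + 2) ⊆ flatsBetween M E₀ M.E (k + 1 + 1) ∪
        {K ∈ flatsBetween M F M.E (k + 2) | ¬ E₀ ⊆ K} := by
      intro K hK
      by_cases h : E₀ ⊆ K
      · exact Or.inl ⟨hK.1, h, hK.2.2⟩
      · exact Or.inr ⟨hK, h⟩
    have hfin : {K ∈ flatsBetween M F M.E (k + 2) | ¬ E₀ ⊆ K}.Finite :=
      finite_flatsBetween.subset fun K hK => hK.1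
    have hcount : {K ∈ flatsBetween M F M.E (k + 2) | ¬ E₀ ⊆ K}.ncard ≤
        q ^ 2 * (flatsBetween M E₀ M.E (k + 1 + 2)).ncard := by
      refine ncard_le_mul_ncard hfin finite_flatsBetween
        (fun K hK => exists_flat_above hF hFk hE₀ hK.1 hK.2) fun G hG => ?_
      have h1 := ncard_not_subset_le hq hM hF hG.1 hFk
        (by rw [hG.2.2.2]) ⟨hE₀.1, hE₀.2.1, hG.2.1, hE₀.2.2.2⟩
      refine le_trans (ncard_le_ncard ?_ (finite_flatsBetween.subset fun K hK => hK.1)) h1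
      rintro K ⟨⟨hK, hne⟩, hKG⟩
      exact ⟨⟨hK.1, hK.2.1, hKG, hK.2.2.2⟩, hne⟩
    calc (flatsBetween M F M.E (k + 2)).ncard
        ≤ (flatsBetween M E₀ M.E (k + 1 + 1)).ncard +
          {K ∈ flatsBetween M F M.E (k + 2) | ¬ E₀ ⊆ K}.ncard :=
          (ncard_le_ncard hsub (finite_flatsBetween.union hfin)).trans (ncard_union_le _ _)
      _ ≤ ∑ i ∈ Finset.range m, q ^ i + q ^ 2 * lineBound q m :=
          add_le_add hcov (hcount.trans (Nat.mul_le_mul_left _ hih))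

end Induction

lemma lineBound_eq (hq : 2 ≤ q) (m : ℕ) : (lineBound q m : ℚ) = qBinomTwo q m := by
  have hq' : (2 : ℚ) ≤ q := by exact_mod_cast hq
  have h1 : (q : ℚ) - 1 ≠ 0 := by linarith
  have h2 : (q : ℚ) ^ 2 - 1 ≠ 0 := by nlinarith
  have hgeom : ∀ n : ℕ,
      ((∑ i ∈ Finset.range n, q ^ i : ℕ) : ℚ) * ((q : ℚ) - 1) = (q : ℚ) ^ n - 1 := by
    intro n
    push_cast
    exact geom_sum_mul _ _
  rw [qBinomTwo, eq_div_iff (mul_ne_zero h1 h2)]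
  induction m with
  | zero => simp [lineBound]
  | succ m ih =>
    rw [lineBound]
    have h3 := hgeom m
    push_cast at h3 ⊢
    rw [add_mul, mul_assoc _ (lineBound q m : ℚ), ih, ← mul_assoc, h3]
    cases m with
    | zero => simp
    | succ m =>
      simp only [Nat.add_sub_cancel]
      ring

end LinesMatroid

theorem mainTheorem2 {α : Type*} (M : Matroid α) [M.Finite] (q r : ℕ)
    (hq : q ∈ ({2, 3, 4, 5} : Set ℕ)) (hM : LinesMatroid.NoLineMinor q M) (hr : M.eRank = r) :
    (LinesMatroid.numLines M : ℚ) ≤ LinesMatroid.qBinomTwo q r := by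
  have hq2 : 2 ≤ q := by
    simp only [Set.mem_insert_iff, Set.mem_singleton_iff] at hq
    omega
  have h1 := LinesMatroid.ncard_lines_le hq hM r (M.isFlat_closure ∅) (k := 0) (by simp)
    (by simpa using hr)
  have h2 : LinesMatroid.lines M ⊆ LinesMatroid.flatsBetween M (M.closure ∅) M.E (0 + 2) := by
    rintro L ⟨hL, hL2⟩
    refine ⟨hL, ?_, hL.subset_ground, by simpa using hL2⟩
    conv_rhs => rw [← hL.closure]
    exact M.closure_subset_closure (Set.empty_subset L)
  rw [← LinesMatroid.lineBound_eq hq2]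
  exact_mod_cast (Set.ncard_le_ncard h2 LinesMatroid.finite_flatsBetween).trans h1
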